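/- Let $\boldsymbol\beta=\{\beta_n\}_{n\in\mathbb N}$ be a sequence in $[-1,\infty)$, and put $H=\{n:\beta_n=-1\}$ and $B=\{n:\beta_n\neq-1\}$. Let $A^2_{\boldsymbol\beta}$ be the Hilbert space of all series $G=\sum_\alpha c_\alpha\zeta^\alpha$ in the variables $\zeta_1,\zeta_2,\dots$, where $\alpha$ runs over the finitely supported sequences of nonnegative integers, with $$\|G\|^2=\sum_\alpha|c_\alpha|^2\omega_\alpha<\infty,\qquad \omega_\alpha=\prod_n\frac{\alpha_n!\,\Gamma(\beta_n+2)}{\Gamma(\alpha_n+\beta_n+2)}.$$ The ring $\mathcal P_\infty$ of complex polynomials in the variables $\zeta_1,\zeta_2,\dots$ acts on $A^2_{\boldsymbol\beta}$ by multiplication. A submodule of $A^2_{\boldsymbol\beta}$ is a closed subspace invariant under this action, and $[G]$ denotes the submodule generated by $G$. Two submodules $M,N$ are unitarily equivalent if there is a unitary map $U$ of $M$ onto $N$ with $U(ph)=p\,Uh$ for all $p\in\mathcal P_\infty$ and $h\in M$. The unitary orbit $\mathrm{orb}_u(M)$ is the set of all submodules of $A^2_{\boldsymbol\beta}$ that are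 unitarily equivalent to $M$. Let $H^2(\mathbb D_2^H)$ be the space of all $F\in A^2_{\boldsymbol\beta}$ that involve only the variables $\zeta_n$ with $n\in H$. Such an $F$ is a function on $\mathbb D_2^H=\{\zeta\in\ell^2: |\zeta_n|<1 \text{ for all } n,\ \zeta_n=0 \text{ for } n\notin H\}$, and it has a boundary function $F^*\in L^2(\mathbb T^H,\sigma_H)$, where $\sigma_H$ is the normalized Haar measure of the torus $\mathbb T^H$: the map $F\mapsto F^*$ is the linear isometry that sends each monomial to its restriction to $\mathbb T^H$. Call $F$ inner if $F$ is bounded on $\mathbb D_2^H$ and $|F^*|=1$ $\sigma_H$-almost everywhere. **Theorem.** Let $\gamma$ be a finitely supported sequence of nonnegative integers, and let $\tilde\gamma_n=\gamma_n$ for $n\in B$ and $\tilde\gamma_n=0$ for $n\in H$. Then $$\mathrm{orb}_u([\zeta^\gamma])=\left\{F[\zeta^{\tilde\gamma}] : F\in H^2(\mathbb D_2^H)\text{ is inner}\right\},$$ where $F[\zeta^{\tilde\gamma}]=\{FG : G\in[\zeta^{\tilde\gamma}]\}$. -/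

import Mathlib

noncomputable section

namespace WeightedBergman

open MeasureTheory

/-! ### The space -/

/-- The squared norm `‖ζ^α‖² = ∏ₙ αₙ! Γ(βₙ + 2) / Γ(αₙ + βₙ + 2)` of the monomial `ζ^α`.
The factors with `αₙ = 0` equal `1`, so the product runs over the support of `α`. -/
def weight (β : ℕ → Set.Ici (-1 : ℝ)) (α : ℕ →₀ ℕ) : ℝ :=
  α.prod fun n k =>
    (k.factorial : ℝ) * Real.Gamma ((β n : ℝ) + 2) / Real.Gamma ((k : ℝ) + (β n : ℝ) + 2)

theorem weight_pos (β : ℕ → Set.Ici (-1 : ℝ)) (α : ℕ →₀ ℕ) : 0 < weight β α := by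
  refine Finset.prod_pos fun n _ => ?_
  have h : (-1 : ℝ) ≤ β n := (β n).2
  have h1 : 0 < Real.Gamma ((β n : ℝ) + 2) := Real.Gamma_pos_of_pos (by linarith)
  have h2 : 0 < Real.Gamma ((α n : ℝ) + (β n : ℝ) + 2) :=
    Real.Gamma_pos_of_pos (by have : (0 : ℝ) ≤ α n := Nat.cast_nonneg _
                              linarith)
  positivity

theorem factor_antitone {b : ℝ} (hb : -1 ≤ b) (k l : ℕ) :
    ((l + k).factorial : ℝ) * Real.Gamma (b + 2) / Real.Gamma (((l + k : ℕ) : ℝ) + b + 2) ≤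
      (k.factorial : ℝ) * Real.Gamma (b + 2) / Real.Gamma ((k : ℝ) + b + 2) := by
  induction l with
  | zero => simp
  | succ l ih =>
    refine le_trans ?_ ih
    set m := l + k with hm
    have h1 : 0 < Real.Gamma (b + 2) := Real.Gamma_pos_of_pos (by linarith)
    have h0 : (0 : ℝ) ≤ m := Nat.cast_nonneg _
    have h2 : 0 < Real.Gamma ((m : ℝ) + b + 2) := Real.Gamma_pos_of_pos (by linarith)
    have e : l + 1 + k = m + 1 := by omega
    have h3 : Real.Gamma (((m + 1 : ℕ) : ℝ) + b + 2)
        = ((m : ℝ) + b + 2) * Real.Gamma ((m : ℝ) + b + 2) := by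
      rw [← Real.Gamma_add_one (by linarith)]
      congr 1
      push_cast
      ring
    rw [e, h3, Nat.factorial_succ, div_le_div_iff₀ (mul_pos (by linarith) h2) h2]
    push_cast
    have : 0 ≤ (m.factorial : ℝ) * Real.Gamma (b + 2) * Real.Gamma ((m : ℝ) + b + 2) := by
      positivity
    nlinarith

theorem weight_add_le (β : ℕ → Set.Ici (-1 : ℝ)) (δ α : ℕ →₀ ℕ) :
    weight β (δ + α) ≤ weight β α := by
  classical
  have key : ∀ n, (Nat.factorial 0 : ℝ) * Real.Gamma ((β n : ℝ) + 2) /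
      Real.Gamma (((0 : ℕ) : ℝ) + (β n : ℝ) + 2) = 1 := fun n => by
    have h : (-1 : ℝ) ≤ β n := (β n).2
    have h1 : 0 < Real.Gamma ((β n : ℝ) + 2) := Real.Gamma_pos_of_pos (by linarith)
    simp [h1.ne']
  unfold weight
  rw [Finsupp.prod_of_support_subset (δ + α) (s := δ.support ∪ α.support)
      Finsupp.support_add _ (fun n _ => key n),
    Finsupp.prod_of_support_subset α (s := δ.support ∪ α.support)
      Finset.subset_union_right _ (fun n _ => key n)]
  refine Finset.prod_le_prod (fun n _ => ?_) (fun n _ => ?_)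
  · have h : (-1 : ℝ) ≤ β n := (β n).2
    have h1 : 0 < Real.Gamma ((β n : ℝ) + 2) := Real.Gamma_pos_of_pos (by linarith)
    have h2 : 0 < Real.Gamma (((δ + α) n : ℕ) + (β n : ℝ) + 2) :=
      Real.Gamma_pos_of_pos (by
        have : (0 : ℝ) ≤ ((δ + α) n : ℕ) := Nat.cast_nonneg _
        linarith)
    positivity
  · exact factor_antitone (β n).2 (α n) (δ n)

/-- The weighted `ℓ²` coordinates `c_α √ω_α` of a formal power series `∑ c_α ζ^α`. -/
def coords (β : ℕ → Set.Ici (-1 : ℝ)) : MvPowerSeries ℕ ℂ →ₗ[ℂ] ((ℕ →₀ ℕ) → ℂ) where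
  toFun F α := MvPowerSeries.coeff α F * (Real.sqrt (weight β α) : ℂ)
  map_add' F G := by
    funext α
    simp [add_mul]
  map_smul' c F := by
    funext α
    simp [mul_assoc]

theorem norm_coords_sq (β : ℕ → Set.Ici (-1 : ℝ)) (F : MvPowerSeries ℕ ℂ) (α : ℕ →₀ ℕ) :
    ‖coords β F α‖ ^ 2 = ‖MvPowerSeries.coeff α F‖ ^ 2 * weight β α := by
  simp [coords, mul_pow, Real.sq_sqrt (weight_pos β α).le, abs_of_nonneg (Real.sqrt_nonneg _)]

theorem memlp_coords_iff (β : ℕ → Set.Ici (-1 : ℝ)) (F : MvPowerSeries ℕ ℂ) :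
    Memℓp (coords β F) 2 ↔
      Summable fun α : ℕ →₀ ℕ => ‖MvPowerSeries.coeff α F‖ ^ 2 * weight β α := by
  rw [memℓp_gen_iff (by norm_num)]
  simp only [ENNReal.toReal_ofNat, Real.rpow_ofNat, norm_coords_sq]

/-- The weighted Bergman space `A²_β` in infinitely many variables: all series `∑ c_α ζ^α` in
the variables `ζₙ` with `∑ |c_α|² ‖ζ^α‖² < ∞`. -/
def A2 (β : ℕ → Set.Ici (-1 : ℝ)) : Submodule ℂ (MvPowerSeries ℕ ℂ) where
  carrier := {F | Summable fun α : ℕ →₀ ℕ => ‖MvPowerSeries.coeff α F‖ ^ 2 * weight β α}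
  add_mem' {F G} hF hG := by
    have hF' := (memlp_coords_iff β F).2 hF
    have hG' := (memlp_coords_iff β G).2 hG
    exact (memlp_coords_iff β _).1 (by rw [map_add]; exact hF'.add hG')
  zero_mem' := by simp
  smul_mem' c F hF := by
    have hF' := (memlp_coords_iff β F).2 hF
    exact (memlp_coords_iff β _).1 (by rw [map_smul]; exact hF'.const_smul c)

/-- The coordinate map `A²_β → ℓ²`, along which the Hilbert space structure is transported. -/
def toL2 (β : ℕ → Set.Ici (-1 : ℝ)) : A2 β →ₗ[ℂ] lp (fun _ : ℕ →₀ ℕ => ℂ) 2 where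
  toFun F := ⟨coords β F, (memlp_coords_iff β F).2 F.2⟩
  map_add' F G := Subtype.ext ((coords β).map_add F G)
  map_smul' c F := Subtype.ext ((coords β).map_smul c F)

theorem toL2_injective (β : ℕ → Set.Ici (-1 : ℝ)) : Function.Injective (toL2 β) := by
  intro F G h
  refine Subtype.ext (MvPowerSeries.ext fun α => ?_)
  have h1 : coords β F α = coords β G α := congrFun (congrArg Subtype.val h) α
  have h2 : (Real.sqrt (weight β α) : ℂ) ≠ 0 := by
    exact_mod_cast (Real.sqrt_pos.2 (weight_pos β α)).ne'
  exact mul_right_cancel₀ h2 h1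

instance (β : ℕ → Set.Ici (-1 : ℝ)) : NormedAddCommGroup (A2 β) :=
  NormedAddCommGroup.induced (A2 β) (lp (fun _ : ℕ →₀ ℕ => ℂ) 2) (toL2 β) (toL2_injective β)

instance (β : ℕ → Set.Ici (-1 : ℝ)) : InnerProductSpace ℂ (A2 β) :=
  InnerProductSpace.induced (toL2 β)

theorem norm_sq_eq (β : ℕ → Set.Ici (-1 : ℝ)) (F : A2 β) :
    HasSum (fun α : ℕ →₀ ℕ => ‖MvPowerSeries.coeff α (F : MvPowerSeries ℕ ℂ)‖ ^ 2 * weight β α)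
      (‖F‖ ^ 2) := by
  have h := lp.hasSum_norm (p := 2) (by norm_num) (toL2 β F)
  simp only [ENNReal.toReal_ofNat, Real.rpow_ofNat] at h
  have e : (fun α => ‖(toL2 β F : (ℕ →₀ ℕ) → ℂ) α‖ ^ 2) =
      fun α => ‖MvPowerSeries.coeff α (F : MvPowerSeries ℕ ℂ)‖ ^ 2 * weight β α :=
    funext fun α => norm_coords_sq β F α
  rw [e] at h
  exact h

/-! ### The action of polynomials -/

theorem monomial_mul_aux (β : ℕ → Set.Ici (-1 : ℝ)) (δ : ℕ →₀ ℕ) (a : ℂ) (F : A2 β) :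
    ∃ s ≤ (‖a‖ * ‖F‖) ^ 2, HasSum (fun α : ℕ →₀ ℕ => ‖MvPowerSeries.coeff α
      (MvPowerSeries.monomial δ a * (F : MvPowerSeries ℕ ℂ))‖ ^ 2 * weight β α) s := by
  have inj : Function.Injective fun α : ℕ →₀ ℕ => δ + α := add_right_injective δ
  have h0 : ∀ x ∉ Set.range (fun α : ℕ →₀ ℕ => δ + α), ‖MvPowerSeries.coeff x
      (MvPowerSeries.monomial δ a * (F : MvPowerSeries ℕ ℂ))‖ ^ 2 * weight β x = 0 := by
    intro x hx
    rw [MvPowerSeries.coeff_monomial_mul, if_neg]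
    · simp
    · intro hle
      exact hx ⟨x - δ, add_tsub_cancel_of_le hle⟩
  have hF := (norm_sq_eq β F).mul_left (‖a‖ ^ 2)
  have hle : ∀ α : ℕ →₀ ℕ, ‖MvPowerSeries.coeff (δ + α)
      (MvPowerSeries.monomial δ a * (F : MvPowerSeries ℕ ℂ))‖ ^ 2 * weight β (δ + α) ≤
      ‖a‖ ^ 2 * (‖MvPowerSeries.coeff α (F : MvPowerSeries ℕ ℂ)‖ ^ 2 * weight β α) := by
    intro α
    rw [MvPowerSeries.coeff_add_monomial_mul, norm_mul, mul_pow, mul_assoc]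
    have := weight_add_le β δ α
    gcongr
  have hs : Summable fun α : ℕ →₀ ℕ => ‖MvPowerSeries.coeff (δ + α)
      (MvPowerSeries.monomial δ a * (F : MvPowerSeries ℕ ℂ))‖ ^ 2 * weight β (δ + α) :=
    Summable.of_nonneg_of_le (fun α => mul_nonneg (sq_nonneg _) (weight_pos β _).le) hle
      hF.summable
  refine ⟨_, ?_, (inj.hasSum_iff h0).1 hs.hasSum⟩
  rw [mul_pow]
  exact hasSum_le hle hs.hasSum hF

theorem poly_mul_mem (β : ℕ → Set.Ici (-1 : ℝ)) (p : MvPolynomial ℕ ℂ) (F : A2 β) :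
    (p : MvPowerSeries ℕ ℂ) * (F : MvPowerSeries ℕ ℂ) ∈ A2 β := by
  induction p using MvPolynomial.induction_on' with
  | monomial δ a =>
    obtain ⟨s, -, hs⟩ := monomial_mul_aux β δ a F
    rw [MvPolynomial.coe_monomial]
    exact hs.summable
  | add p q hp hq =>
    rw [MvPolynomial.coe_add, add_mul]
    exact add_mem hp hq

/-- `A²_β` as a module over the polynomial ring, which acts by multiplication. -/
instance (β : ℕ → Set.Ici (-1 : ℝ)) : Module (MvPolynomial ℕ ℂ) (A2 β) where
  smul p F := ⟨(p : MvPowerSeries ℕ ℂ) * (F : MvPowerSeries ℕ ℂ), poly_mul_mem β p F⟩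
  one_smul F := Subtype.ext (by
    change ((1 : MvPolynomial ℕ ℂ) : MvPowerSeries ℕ ℂ) * F = F
    rw [MvPolynomial.coe_one, one_mul])
  mul_smul p q F := Subtype.ext (by
    change ((p * q : MvPolynomial ℕ ℂ) : MvPowerSeries ℕ ℂ) * F = p * (q * F)
    rw [MvPolynomial.coe_mul, mul_assoc])
  smul_zero p := Subtype.ext (mul_zero _)
  smul_add p F G := Subtype.ext (mul_add _ _ _)
  add_smul p q F := Subtype.ext (by
    change ((p + q : MvPolynomial ℕ ℂ) : MvPowerSeries ℕ ℂ) * F = p * F + q * F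
    rw [MvPolynomial.coe_add, add_mul])
  zero_smul F := Subtype.ext (by
    change ((0 : MvPolynomial ℕ ℂ) : MvPowerSeries ℕ ℂ) * F = 0
    rw [MvPolynomial.coe_zero, zero_mul])

theorem coe_poly_smul (β : ℕ → Set.Ici (-1 : ℝ)) (p : MvPolynomial ℕ ℂ) (F : A2 β) :
    ((p • F : A2 β) : MvPowerSeries ℕ ℂ) = (p : MvPowerSeries ℕ ℂ) * (F : MvPowerSeries ℕ ℂ) :=
  rfl

/-- Constant polynomials act as scalars. -/
instance (β : ℕ → Set.Ici (-1 : ℝ)) : IsScalarTower ℂ (MvPolynomial ℕ ℂ) (A2 β) where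
  smul_assoc c p F := Subtype.ext (by
    change ((c • p : MvPolynomial ℕ ℂ) : MvPowerSeries ℕ ℂ) * F = c • (p * F)
    rw [MvPolynomial.coe_smul, smul_mul_assoc])

theorem exists_poly_bound (β : ℕ → Set.Ici (-1 : ℝ)) (p : MvPolynomial ℕ ℂ) :
    ∃ C : ℝ, ∀ F : A2 β, ‖p • F‖ ≤ C * ‖F‖ := by
  induction p using MvPolynomial.induction_on' with
  | monomial δ a =>
    refine ⟨‖a‖, fun F => ?_⟩
    obtain ⟨s, hle, hs⟩ := monomial_mul_aux β δ a F
    have h := norm_sq_eq β (MvPolynomial.monomial δ a • F)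
    rw [coe_poly_smul, MvPolynomial.coe_monomial] at h
    rw [← h.unique hs] at hle
    exact le_of_sq_le_sq hle (by positivity)
  | add p q hp hq =>
    obtain ⟨C, hC⟩ := hp
    obtain ⟨D, hD⟩ := hq
    refine ⟨C + D, fun F => ?_⟩
    rw [add_smul, add_mul]
    exact (norm_add_le _ _).trans (add_le_add (hC F) (hD F))

/-- Every polynomial acts as a bounded operator. -/
instance (β : ℕ → Set.Ici (-1 : ℝ)) : ContinuousConstSMul (MvPolynomial ℕ ℂ) (A2 β) where
  continuous_const_smul p := by
    obtain ⟨C, hC⟩ := exists_poly_bound β p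
    exact AddMonoidHomClass.continuous_of_bound (DistribSMul.toAddMonoidHom (A2 β) p) C hC

/-! ### Submodules, generators, unitary orbits -/

/-- A submodule of the Hilbert module `A²_β`: a closed subspace invariant under multiplication
by all polynomials. -/
abbrev HilbertSubmodule (β : ℕ → Set.Ici (-1 : ℝ)) : Type :=
  ClosedSubmodule (MvPolynomial ℕ ℂ) (A2 β)

/-- The submodule `[𝓕]` generated by a subset `𝓕` of `A²_β`. -/
def generated (β : ℕ → Set.Ici (-1 : ℝ)) (𝓕 : Set (A2 β)) : HilbertSubmodule β :=
  (Submodule.span (MvPolynomial ℕ ℂ) 𝓕).closure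

/-- The constant function `1` as an element of `A²_β`. -/
def one (β : ℕ → Set.Ici (-1 : ℝ)) : A2 β :=
  ⟨1, by
    classical
    refine summable_of_ne_finset_zero (s := {0}) fun α hα => ?_
    rw [MvPowerSeries.coeff_one, if_neg (by simpa using hα)]
    simp⟩

/-- The monomial `ζ^γ` as an element of `A²_β`. -/
def zetaPow (β : ℕ → Set.Ici (-1 : ℝ)) (γ : ℕ →₀ ℕ) : A2 β :=
  MvPolynomial.monomial γ (1 : ℂ) • one β

/-- `M` and `N` are unitarily equivalent: there is a unitary map of `M` onto `N` that commutes
with the action of the polynomials (such a map is in particular complex linear). -/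
def UnitarilyEquivalent {β : ℕ → Set.Ici (-1 : ℝ)} (M N : HilbertSubmodule β) : Prop :=
  ∃ U : M.toSubmodule ≃ₗ[MvPolynomial ℕ ℂ] N.toSubmodule, ∀ h, ‖U h‖ = ‖h‖

/-- The unitary orbit of `M`. -/
def unitaryOrbit {β : ℕ → Set.Ici (-1 : ℝ)} (M : HilbertSubmodule β) :
    Set (HilbertSubmodule β) :=
  {N | UnitarilyEquivalent M N}

/-- The set of power series belonging to a submodule of `A²_β`. -/
def seriesSet {β : ℕ → Set.Ici (-1 : ℝ)} (M : HilbertSubmodule β) : Set (MvPowerSeries ℕ ℂ) :=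
  Subtype.val '' (M : Set (A2 β))

/-! ### Inner functions -/

/-- The set `H` of Hardy indices. -/
def hardyIndex (β : ℕ → Set.Ici (-1 : ℝ)) : Set ℕ := {n | (β n : ℝ) = -1}

/-- The Hardy space `H²(𝔻₂^H)`: the functions in `A²_β` whose expansion involves only the
variables `ζₙ` with `n ∈ H`. -/
def hardySpace (β : ℕ → Set.Ici (-1 : ℝ)) : Set (A2 β) :=
  {F | ∀ α : ℕ →₀ ℕ, MvPowerSeries.coeff α (F : MvPowerSeries ℕ ℂ) ≠ 0 →
    (α.support : Set ℕ) ⊆ hardyIndex β}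

/-- The multidisk `𝔻₂^H`: the square-summable sequences in the unit disk supported in `H`. -/
def hardyDisk (β : ℕ → Set.Ici (-1 : ℝ)) : Set (ℕ → ℂ) :=
  {z | (Summable fun n => ‖z n‖ ^ 2) ∧ (∀ n, ‖z n‖ < 1) ∧ ∀ n ∉ hardyIndex β, z n = 0}

/-- The value `F(z) = ∑ c_α z^α`; for `F` in the Hardy space and `z ∈ 𝔻₂^H` the series
converges absolutely. -/
def evalAt (F : MvPowerSeries ℕ ℂ) (z : ℕ → ℂ) : ℂ :=
  ∑' α : ℕ →₀ ℕ, MvPowerSeries.coeff α F * α.prod fun n k => z n ^ k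

instance : MeasurableSpace Circle := borel Circle

instance : BorelSpace Circle := ⟨rfl⟩

/-- The torus `𝕋^H`. -/
abbrev torus (β : ℕ → Set.Ici (-1 : ℝ)) : Type := hardyIndex β → Circle

/-- The normalized Haar measure `σ_H` of `𝕋^H`. -/
def torusHaar (β : ℕ → Set.Ici (-1 : ℝ)) : Measure (torus β) :=
  Measure.haarMeasure ⊤

instance (β : ℕ → Set.Ici (-1 : ℝ)) : IsProbabilityMeasure (torusHaar β) :=
  ⟨Measure.haarMeasure_self (K₀ := (⊤ : TopologicalSpace.PositiveCompacts (torus β)))⟩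

/-- A point of `𝕋^H` as a sequence, with the entry `1` outside `H`. -/
def torusPoint {β : ℕ → Set.Ici (-1 : ℝ)} (t : torus β) (n : ℕ) : Circle :=
  haveI := Classical.dec (n ∈ hardyIndex β)
  if h : n ∈ hardyIndex β then t ⟨n, h⟩ else 1

theorem continuous_torusPoint {β : ℕ → Set.Ici (-1 : ℝ)} (n : ℕ) :
    Continuous fun t : torus β => torusPoint t n := by
  unfold torusPoint
  split_ifs with h
  · exact continuous_apply _
  · exact continuous_const

/-- The monomial `ζ^α` as a continuous function on `𝕋^H`. -/
def torusMonomial (β : ℕ → Set.Ici (-1 : ℝ)) (α : ℕ →₀ ℕ) : C(torus β, ℂ) where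
  toFun t := α.prod fun n k => (torusPoint t n : ℂ) ^ k
  continuous_toFun := continuous_finsetProd _ fun n _ =>
    (continuous_subtype_val.comp (continuous_torusPoint n)).pow _

/-- `g ∈ L²(𝕋^H, σ_H)` is the boundary function of `F = ∑ c_α ζ^α` in the Hardy space: the
image of `F` under the isometry of `H²(𝔻₂^H)` into `L²(𝕋^H, σ_H)` that sends each monomial to
its restriction to the torus. -/
def IsBoundaryFunction {β : ℕ → Set.Ici (-1 : ℝ)} (F : A2 β)
    (g : Lp ℂ 2 (torusHaar β)) : Prop :=
  HasSum (fun α : ℕ →₀ ℕ => MvPowerSeries.coeff α (F : MvPowerSeries ℕ ℂ) •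
    ContinuousMap.toLp (E := ℂ) 2 (torusHaar β) ℂ (torusMonomial β α)) g

/-- `F ∈ H²(𝔻₂^H)` is inner: it is bounded on `𝔻₂^H`, and its boundary function is unimodular
almost everywhere. -/
structure IsInner {β : ℕ → Set.Ici (-1 : ℝ)} (F : A2 β) : Prop where
  mem_hardySpace : F ∈ hardySpace β
  bounded : ∃ C : ℝ, ∀ z ∈ hardyDisk β, ‖evalAt F z‖ ≤ C
  boundary : ∃ g : Lp ℂ 2 (torusHaar β),
    IsBoundaryFunction F g ∧ ∀ᵐ t ∂(torusHaar β), ‖g t‖ = 1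

/-- The multi-index `γ̃`, which agrees with `γ` on `B` and vanishes on `H`. -/
def bergmanPart (β : ℕ → Set.Ici (-1 : ℝ)) (γ : ℕ →₀ ℕ) : ℕ →₀ ℕ :=
  haveI : DecidablePred fun n => (β n : ℝ) ≠ -1 := Classical.decPred _
  γ.filter fun n => (β n : ℝ) ≠ -1

end WeightedBergman

end

noncomputable section

namespace WeightedBergman

open MeasureTheory ComplexConjugate

/-! ### Hilbert space structure of `A²_β` -/

/-! A unitary module map out of `[ζ^γ]` is determined by the image `K` of `ζ^γ`: the target is
`[K]`, and `‖pK‖ = ‖pζ^γ‖` for every polynomial `p` (`exists_generator_of_unitarilyEquivalent`).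

Rigidity in the Bergman variables comes from norms alone. For `n ∈ B` some real combination of
`‖ζ^κ‖²`, `‖ζₙζ^κ‖²`, `‖ζₙ²ζ^κ‖²` is nonnegative and vanishes exactly when `κₙ = γₙ`
(`weight_combination`). Evaluated on `K` it gives the same value as on `ζ^γ`, namely zero, so every
exponent of `K` agrees with `γ` on `B` and `K = ζ^γ̃ F` with `F` in the Hardy space.

In the Hardy variables all weights are 1. Polarization shows that the products of `F` with the Hardy
monomials are orthonormal, which is the notion `IsIsometricMultiplier`. It is equivalent to being
inner: the Gram matrix consists of the Fourier coefficients of `|F*|² dσ`, and these determine the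
measure (`norm_boundary_eq_one`); boundedness follows because all powers of `F` have the same norm
(`norm_evalAt_le_one`).

Conversely, an isometric multiplier acts isometrically on all of `A²_β`, since the Bergman part of
an exponent contributes the same factor to the Gram matrix of `F` as to that of 1. Hence `F[ζ^γ̃] =
[Fζ^γ̃]` is equivalent to `[ζ^γ̃]`, and multiplication by the Hardy part of `ζ^γ` identifies
`[ζ^γ̃]` with `[ζ^γ]`. -/

theorem weight_add_of_disjoint (β : ℕ → Set.Ici (-1 : ℝ)) {α δ : ℕ →₀ ℕ}
    (h : Disjoint α.support δ.support) : weight β (α + δ) = weight β α * weight β δ :=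
  Finsupp.prod_add_index_of_disjoint h _

/-- At `βₙ = -1` the factor is `k! Γ(1) / Γ(k + 1) = 1`. -/
theorem weight_of_support_subset_hardyIndex (β : ℕ → Set.Ici (-1 : ℝ)) {α : ℕ →₀ ℕ}
    (h : (α.support : Set ℕ) ⊆ hardyIndex β) : weight β α = 1 := by
  refine Finset.prod_eq_one fun n hn => ?_
  have hn : (β n : ℝ) = -1 := h hn
  have e : ((α n : ℝ) + -1 + 2) = (α n : ℝ) + 1 := by ring
  have e' : (-1 + 2 : ℝ) = 1 := by norm_num
  change ((α n).factorial : ℝ) * Real.Gamma ((β n : ℝ) + 2) /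
    Real.Gamma ((α n : ℝ) + (β n : ℝ) + 2) = 1
  rw [hn, e, e', Real.Gamma_nat_eq_factorial, Real.Gamma_one, mul_one, div_self]
  exact_mod_cast (α n).factorial_ne_zero

theorem toL2_apply (β : ℕ → Set.Ici (-1 : ℝ)) (F : A2 β) (α : ℕ →₀ ℕ) :
    (toL2 β F : (ℕ →₀ ℕ) → ℂ) α =
      MvPowerSeries.coeff α (F : MvPowerSeries ℕ ℂ) * (Real.sqrt (weight β α) : ℂ) := rfl

theorem sqrt_weight_ne_zero (β : ℕ → Set.Ici (-1 : ℝ)) (α : ℕ →₀ ℕ) :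
    (Real.sqrt (weight β α) : ℂ) ≠ 0 := by
  exact_mod_cast (Real.sqrt_pos.2 (weight_pos β α)).ne'

theorem sqrt_weight_mul_self (β : ℕ → Set.Ici (-1 : ℝ)) (α : ℕ →₀ ℕ) :
    (Real.sqrt (weight β α) : ℂ) * (Real.sqrt (weight β α) : ℂ) = (weight β α : ℂ) := by
  exact_mod_cast Real.mul_self_sqrt (weight_pos β α).le

theorem toL2_surjective (β : ℕ → Set.Ici (-1 : ℝ)) : Function.Surjective (toL2 β) := by
  intro f
  have e : coords β (fun α => (f : (ℕ →₀ ℕ) → ℂ) α / (Real.sqrt (weight β α) : ℂ)) = f := by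
    funext α
    exact div_mul_cancel₀ _ (sqrt_weight_ne_zero β α)
  exact ⟨⟨_, (memlp_coords_iff β _).1 (by rw [e]; exact lp.memℓp f)⟩, Subtype.ext e⟩

/-- The coordinate map as a unitary map of `A²_β` onto `ℓ²`. -/
def toL2Isometry (β : ℕ → Set.Ici (-1 : ℝ)) : A2 β ≃ₗᵢ[ℂ] lp (fun _ : ℕ →₀ ℕ => ℂ) 2 :=
  LinearIsometryEquiv.ofSurjective ⟨toL2 β, fun _ => rfl⟩ (toL2_surjective β)

instance (β : ℕ → Set.Ici (-1 : ℝ)) : CompleteSpace (A2 β) :=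
  (toL2Isometry β).toIsometryEquiv.completeSpace

theorem hasSum_inner (β : ℕ → Set.Ici (-1 : ℝ)) (F G : A2 β) :
    HasSum (fun α : ℕ →₀ ℕ => conj (MvPowerSeries.coeff α (F : MvPowerSeries ℕ ℂ)) *
      MvPowerSeries.coeff α (G : MvPowerSeries ℕ ℂ) * (weight β α : ℂ)) (inner ℂ F G) := by
  have h := lp.hasSum_inner (𝕜 := ℂ) (toL2 β F) (toL2 β G)
  refine h.congr_fun ?_
  intro α
  rw [toL2_apply, toL2_apply, RCLike.inner_apply, map_mul, Complex.conj_ofReal,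
    ← sqrt_weight_mul_self]
  ring

/-- The coefficient functionals are continuous. -/
def coeffCLM (β : ℕ → Set.Ici (-1 : ℝ)) (α : ℕ →₀ ℕ) : A2 β →L[ℂ] ℂ :=
  LinearMap.mkContinuous
    { toFun := fun F => MvPowerSeries.coeff α (F : MvPowerSeries ℕ ℂ)
      map_add' := fun F G => by simp
      map_smul' := fun c F => by simp }
    (Real.sqrt (weight β α))⁻¹ (fun F => by
      have h := lp.norm_apply_le_norm (p := 2) (by norm_num) (toL2 β F) α
      rw [toL2_apply, norm_mul, Complex.norm_real, Real.norm_of_nonneg (Real.sqrt_nonneg _)] at h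
      rw [inv_mul_eq_div, le_div_iff₀ (Real.sqrt_pos.2 (weight_pos β α))]
      exact h)

theorem coeffCLM_apply (β : ℕ → Set.Ici (-1 : ℝ)) (α : ℕ →₀ ℕ) (F : A2 β) :
    coeffCLM β α F = MvPowerSeries.coeff α (F : MvPowerSeries ℕ ℂ) := rfl

/-- The monomial `ζ^α` as a polynomial. -/
abbrev mono (α : ℕ →₀ ℕ) : MvPolynomial ℕ ℂ := MvPolynomial.monomial α 1

theorem mono_mul_mono (α δ : ℕ →₀ ℕ) : mono α * mono δ = mono (α + δ) := by
  simp [mono, MvPolynomial.monomial_mul]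

theorem coe_mono_smul (β : ℕ → Set.Ici (-1 : ℝ)) (α : ℕ →₀ ℕ) (F : A2 β) :
    ((mono α • F : A2 β) : MvPowerSeries ℕ ℂ) =
      MvPowerSeries.monomial α 1 * (F : MvPowerSeries ℕ ℂ) := by
  rw [coe_poly_smul, MvPolynomial.coe_monomial]

theorem coeff_add_mono_smul (β : ℕ → Set.Ici (-1 : ℝ)) (α κ : ℕ →₀ ℕ) (F : A2 β) :
    MvPowerSeries.coeff (α + κ) ((mono α • F : A2 β) : MvPowerSeries ℕ ℂ) =
      MvPowerSeries.coeff κ (F : MvPowerSeries ℕ ℂ) := by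
  rw [coe_mono_smul, MvPowerSeries.coeff_add_monomial_mul, one_mul]

theorem exists_of_coeff_mono_smul_ne_zero (β : ℕ → Set.Ici (-1 : ℝ)) {α κ : ℕ →₀ ℕ} {F : A2 β}
    (h : MvPowerSeries.coeff κ ((mono α • F : A2 β) : MvPowerSeries ℕ ℂ) ≠ 0) :
    ∃ τ, κ = α + τ ∧ MvPowerSeries.coeff τ (F : MvPowerSeries ℕ ℂ) ≠ 0 := by
  have hle : α ≤ κ := by
    by_contra hle
    refine h ?_
    classical
    rw [coe_mono_smul, MvPowerSeries.coeff_monomial_mul, if_neg hle]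
  obtain ⟨τ, rfl⟩ := exists_add_of_le hle
  rw [coeff_add_mono_smul] at h
  exact ⟨τ, rfl, h⟩

/-- Reindexing by `κ ↦ α + κ` moves the shift from the coefficients to the weight, so that norms of
different monomial multiples of one series become sums over the same coefficients and can be
combined linearly. -/
theorem hasSum_inner_mono_smul (β : ℕ → Set.Ici (-1 : ℝ)) (α : ℕ →₀ ℕ) (F G : A2 β) :
    HasSum (fun κ : ℕ →₀ ℕ => conj (MvPowerSeries.coeff κ (F : MvPowerSeries ℕ ℂ)) *
      MvPowerSeries.coeff κ (G : MvPowerSeries ℕ ℂ) * (weight β (α + κ) : ℂ))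
      (inner ℂ (mono α • F) (mono α • G)) := by
  have h := hasSum_inner β (mono α • F) (mono α • G)
  rw [← (add_right_injective α).hasSum_iff] at h
  · simpa only [Function.comp_def, coeff_add_mono_smul] using h
  · intro x hx
    have : MvPowerSeries.coeff x ((mono α • F : A2 β) : MvPowerSeries ℕ ℂ) = 0 := by
      by_contra hne
      obtain ⟨τ, rfl, -⟩ := exists_of_coeff_mono_smul_ne_zero β hne
      exact hx ⟨τ, rfl⟩
    rw [this]
    simp

theorem coeff_one_eq (β : ℕ → Set.Ici (-1 : ℝ)) (α : ℕ →₀ ℕ) [Decidable (α = 0)] :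
    MvPowerSeries.coeff α (one β : MvPowerSeries ℕ ℂ) = if α = 0 then 1 else 0 := by
  classical
  change MvPowerSeries.coeff α (1 : MvPowerSeries ℕ ℂ) = _
  rw [MvPowerSeries.coeff_one]
  congr

theorem zetaPow_eq (β : ℕ → Set.Ici (-1 : ℝ)) (γ : ℕ →₀ ℕ) : zetaPow β γ = mono γ • one β := rfl

theorem mono_smul_zetaPow (β : ℕ → Set.Ici (-1 : ℝ)) (α γ : ℕ →₀ ℕ) :
    mono α • zetaPow β γ = zetaPow β (α + γ) := by
  rw [zetaPow_eq, zetaPow_eq, ← mul_smul, mono_mul_mono]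

theorem coeff_zetaPow (β : ℕ → Set.Ici (-1 : ℝ)) (α γ : ℕ →₀ ℕ) [Decidable (α = γ)] :
    MvPowerSeries.coeff α (zetaPow β γ : MvPowerSeries ℕ ℂ) = if α = γ then 1 else 0 := by
  classical
  split_ifs with h
  · subst h
    have := coeff_add_mono_smul β α 0 (one β)
    rw [add_zero, coeff_one_eq, if_pos rfl] at this
    exact this
  · by_contra hne
    obtain ⟨τ, rfl, hτ⟩ := exists_of_coeff_mono_smul_ne_zero β hne
    rw [coeff_one_eq] at hτ
    refine h ?_
    simpa using hτ

theorem inner_zetaPow (β : ℕ → Set.Ici (-1 : ℝ)) (α γ : ℕ →₀ ℕ) [Decidable (α = γ)] :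
    inner ℂ (zetaPow β α) (zetaPow β γ) = if α = γ then (weight β α : ℂ) else 0 := by
  classical
  refine (hasSum_inner β _ _).unique ?_
  simp only [coeff_zetaPow]
  split_ifs with h
  · subst h
    convert hasSum_ite_eq α (weight β α : ℂ) using 2 with κ
    split_ifs with hκ
    · simp [hκ]
    · simp
  · convert hasSum_zero using 2 with κ
    by_cases hκ : κ = α
    · simp [hκ, h]
    · simp [hκ]

theorem mono_smul_mem_hardySpace (β : ℕ → Set.Ici (-1 : ℝ)) {α : ℕ →₀ ℕ}
    (h : (α.support : Set ℕ) ⊆ hardyIndex β) {F : A2 β} (hF : F ∈ hardySpace β) :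
    mono α • F ∈ hardySpace β := by
  intro κ hκ
  obtain ⟨τ, rfl, hτ⟩ := exists_of_coeff_mono_smul_ne_zero β hκ
  intro n hn
  rcases Finset.mem_union.1 (Finsupp.support_add hn) with h1 | h1
  · exact h h1
  · exact hF τ hτ h1

/-! ### Splitting multi-indices into Hardy and Bergman parts -/

/-- The multi-index which agrees with `γ` on `H` and vanishes on `B`. -/
def hardyPart (β : ℕ → Set.Ici (-1 : ℝ)) (γ : ℕ →₀ ℕ) : ℕ →₀ ℕ :=
  haveI : DecidablePred fun n => ¬ (β n : ℝ) ≠ -1 := Classical.decPred _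
  γ.filter fun n => ¬ (β n : ℝ) ≠ -1

theorem bergmanPart_add_hardyPart (β : ℕ → Set.Ici (-1 : ℝ)) (γ : ℕ →₀ ℕ) :
    bergmanPart β γ + hardyPart β γ = γ := by
  ext n
  by_cases h : n ∈ hardyIndex β
  · have h' : ¬ (β n : ℝ) ≠ -1 := not_not.2 h
    simp only [bergmanPart, hardyPart, Finsupp.add_apply, Finsupp.filter_apply, if_neg h', if_pos h',
      zero_add]
  · have h' : ¬ ¬ (β n : ℝ) ≠ -1 := not_not.2 h
    simp only [bergmanPart, hardyPart, Finsupp.add_apply, Finsupp.filter_apply, if_neg h',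
      if_pos (not_not.1 h'), add_zero]

theorem bergmanPart_apply_of_mem (β : ℕ → Set.Ici (-1 : ℝ)) (γ : ℕ →₀ ℕ) {n : ℕ}
    (h : n ∈ hardyIndex β) : bergmanPart β γ n = 0 := by
  unfold bergmanPart
  rw [Finsupp.filter_apply]
  exact if_neg (not_not.2 h)

theorem bergmanPart_apply_of_notMem (β : ℕ → Set.Ici (-1 : ℝ)) (γ : ℕ →₀ ℕ) {n : ℕ}
    (h : n ∉ hardyIndex β) : bergmanPart β γ n = γ n := by
  unfold bergmanPart
  rw [Finsupp.filter_apply]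
  exact if_pos h

theorem support_hardyPart (β : ℕ → Set.Ici (-1 : ℝ)) (γ : ℕ →₀ ℕ) :
    ((hardyPart β γ).support : Set ℕ) ⊆ hardyIndex β := by
  intro n hn
  by_contra h
  have : hardyPart β γ n = 0 := by
    unfold hardyPart
    rw [Finsupp.filter_apply]
    exact if_neg (not_not.2 h)
  simp [this] at hn

theorem bergmanPart_eq_zero_iff (β : ℕ → Set.Ici (-1 : ℝ)) (γ : ℕ →₀ ℕ) :
    bergmanPart β γ = 0 ↔ (γ.support : Set ℕ) ⊆ hardyIndex β := by
  constructor
  · intro h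
    rw [← bergmanPart_add_hardyPart β γ, h, zero_add]
    exact support_hardyPart β γ
  · intro h
    ext n
    by_cases hn : n ∈ hardyIndex β
    · exact bergmanPart_apply_of_mem β γ hn
    · rw [bergmanPart_apply_of_notMem β γ hn]
      by_contra h0
      exact hn (h (by simpa using h0))

theorem bergmanPart_add (β : ℕ → Set.Ici (-1 : ℝ)) (α γ : ℕ →₀ ℕ) :
    bergmanPart β (α + γ) = bergmanPart β α + bergmanPart β γ := by
  ext n
  by_cases hn : n ∈ hardyIndex β
  · simp only [Finsupp.add_apply, bergmanPart_apply_of_mem _ _ hn, add_zero]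
  · simp only [Finsupp.add_apply, bergmanPart_apply_of_notMem _ _ hn]

theorem bergmanPart_bergmanPart (β : ℕ → Set.Ici (-1 : ℝ)) (γ : ℕ →₀ ℕ) :
    bergmanPart β (bergmanPart β γ) = bergmanPart β γ := by
  ext n
  by_cases hn : n ∈ hardyIndex β
  · simp only [bergmanPart_apply_of_mem _ _ hn]
  · rw [bergmanPart_apply_of_notMem _ _ hn]

theorem weight_bergmanPart_add (β : ℕ → Set.Ici (-1 : ℝ)) (γ : ℕ →₀ ℕ) {τ : ℕ →₀ ℕ}
    (h : (τ.support : Set ℕ) ⊆ hardyIndex β) :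
    weight β (bergmanPart β γ + τ) = weight β (bergmanPart β γ) := by
  rw [weight_add_of_disjoint, weight_of_support_subset_hardyIndex β h, mul_one]
  rw [Finset.disjoint_left]
  intro n hn hn'
  simp [bergmanPart_apply_of_mem β γ (h hn')] at hn

theorem weight_eq_weight_bergmanPart (β : ℕ → Set.Ici (-1 : ℝ)) (γ : ℕ →₀ ℕ) :
    weight β γ = weight β (bergmanPart β γ) := by
  conv_lhs => rw [← bergmanPart_add_hardyPart β γ]
  exact weight_bergmanPart_add β γ (support_hardyPart β γ)

/-- `ζ^δ H²` and `ζ^δ' H²` are orthogonal for distinct multi-indices in the Bergman variables. -/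
theorem inner_mono_bergmanPart_smul (β : ℕ → Set.Ici (-1 : ℝ)) (δ δ' : ℕ →₀ ℕ)
    [Decidable (bergmanPart β δ = bergmanPart β δ')]
    {P Q : A2 β} (hP : P ∈ hardySpace β) (hQ : Q ∈ hardySpace β) :
    inner ℂ (mono (bergmanPart β δ) • P) (mono (bergmanPart β δ') • Q) =
      if bergmanPart β δ = bergmanPart β δ' then (weight β (bergmanPart β δ) : ℂ) * inner ℂ P Q
      else 0 := by
  split_ifs with h
  · rw [← h]
    refine (hasSum_inner_mono_smul β _ P Q).unique ?_
    refine ((hasSum_inner β P Q).mul_left (weight β (bergmanPart β δ) : ℂ)).congr_fun ?_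
    intro κ
    by_cases hκ : MvPowerSeries.coeff κ (P : MvPowerSeries ℕ ℂ) = 0
    · simp [hκ]
    · rw [weight_bergmanPart_add β δ (hP κ hκ),
        weight_of_support_subset_hardyIndex β (hP κ hκ)]
      push_cast
      ring
  · refine (hasSum_inner β _ _).unique ?_
    convert hasSum_zero using 2 with κ
    by_contra hne
    have h1 : MvPowerSeries.coeff κ
        ((mono (bergmanPart β δ) • P : A2 β) : MvPowerSeries ℕ ℂ) ≠ 0 := by
      rintro h0
      simp [h0] at hne
    have h2 : MvPowerSeries.coeff κ
        ((mono (bergmanPart β δ') • Q : A2 β) : MvPowerSeries ℕ ℂ) ≠ 0 := by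
      rintro h0
      simp [h0] at hne
    obtain ⟨τ, rfl, hτ⟩ := exists_of_coeff_mono_smul_ne_zero β h1
    obtain ⟨τ', e, hτ'⟩ := exists_of_coeff_mono_smul_ne_zero β h2
    -- Taking Bergman parts of the common exponent discards `τ` and `τ'`, which are supported in
    -- `H`.
    refine h ?_
    have e := congrArg (bergmanPart β) e
    rwa [bergmanPart_add, bergmanPart_add, bergmanPart_bergmanPart, bergmanPart_bergmanPart,
      (bergmanPart_eq_zero_iff β τ).2 (hP τ hτ), (bergmanPart_eq_zero_iff β τ').2 (hQ τ' hτ'),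
      add_zero, add_zero] at e

/-! ### Isometric multipliers -/

/-- `F` lies in the Hardy space, and its products with the monomials in the Hardy variables are
orthonormal. -/
structure IsIsometricMultiplier {β : ℕ → Set.Ici (-1 : ℝ)} (F : A2 β) : Prop where
  mem_hardySpace : F ∈ hardySpace β
  inner_eq : ∀ α α' : ℕ →₀ ℕ, (α.support : Set ℕ) ⊆ hardyIndex β →
    (α'.support : Set ℕ) ⊆ hardyIndex β →
      inner ℂ (mono α • F) (mono α' • F) = inner ℂ (zetaPow β α) (zetaPow β α')

/-- The Bergman parts of `α` and `α'` contribute a Kronecker delta times a weight, and this factor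
is the same for `F` as for the Hardy function 1. Only the Hardy parts remain to be compared. -/
theorem IsIsometricMultiplier.inner_eq_inner_zetaPow {β : ℕ → Set.Ici (-1 : ℝ)} {F : A2 β}
    (hF : IsIsometricMultiplier F) (α α' : ℕ →₀ ℕ) :
    inner ℂ (mono α • F) (mono α' • F) = inner ℂ (zetaPow β α) (zetaPow β α') := by
  classical
  have key : ∀ (δ : ℕ →₀ ℕ) (G : A2 β),
      mono δ • G = mono (bergmanPart β δ) • (mono (hardyPart β δ) • G) := by
    intro δ G
    rw [← mul_smul, mono_mul_mono, bergmanPart_add_hardyPart]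
  rw [zetaPow_eq, zetaPow_eq, key α, key α', key α, key α']
  have one_mem : one β ∈ hardySpace β := by
    intro κ hκ
    rw [coeff_one_eq] at hκ
    have : κ = 0 := by by_contra hne; simp [hne] at hκ
    simp [this]
  rw [inner_mono_bergmanPart_smul, inner_mono_bergmanPart_smul,
    hF.inner_eq _ _ (support_hardyPart β α) (support_hardyPart β α')]
  · rfl
  all_goals
    first
    | exact mono_smul_mem_hardySpace β (support_hardyPart β _) one_mem
    | exact mono_smul_mem_hardySpace β (support_hardyPart β _) hF.mem_hardySpace

theorem IsIsometricMultiplier.orthonormal {β : ℕ → Set.Ici (-1 : ℝ)} {F : A2 β}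
    (hF : IsIsometricMultiplier F) :
    Orthonormal ℂ fun α : ℕ →₀ ℕ => ((Real.sqrt (weight β α) : ℂ)⁻¹) • (mono α • F) := by
  classical
  rw [orthonormal_iff_ite]
  intro α α'
  rw [inner_smul_left, inner_smul_right, hF.inner_eq_inner_zetaPow, inner_zetaPow]
  split_ifs with h
  · subst h
    rw [map_inv₀, Complex.conj_ofReal, ← sqrt_weight_mul_self]
    have := sqrt_weight_ne_zero β α
    field_simp
  · simp

/-- The isometry sends the normalized monomials to the orthonormal vectors `ω_α^(-1/2) ζ^α F`.
Continuity of the coefficient functionals identifies it with the formal product, so `FG ∈ A²_β` is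
obtained before `F` is known to be bounded. -/
theorem IsIsometricMultiplier.exists_linearIsometry {β : ℕ → Set.Ici (-1 : ℝ)} {F : A2 β}
    (hF : IsIsometricMultiplier F) :
    ∃ T : A2 β →ₗᵢ[ℂ] A2 β, ∀ G : A2 β,
      (T G : MvPowerSeries ℕ ℂ) = (F : MvPowerSeries ℕ ℂ) * (G : MvPowerSeries ℕ ℂ) := by
  classical
  refine ⟨hF.orthonormal.orthogonalFamily.linearIsometry.comp
    (toL2Isometry β).toLinearIsometry, fun G => MvPowerSeries.ext fun κ => ?_⟩
  have h := (coeffCLM β κ).hasSum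
    (hF.orthonormal.orthogonalFamily.hasSum_linearIsometry (toL2Isometry β G))
  refine h.unique ?_
  have e : ∀ α : ℕ →₀ ℕ, coeffCLM β κ (LinearIsometry.toSpanSingleton ℂ (A2 β)
        (hF.orthonormal.1 α) (toL2Isometry β G α)) =
      MvPowerSeries.coeff α (G : MvPowerSeries ℕ ℂ) *
        MvPowerSeries.coeff κ ((mono α • F : A2 β) : MvPowerSeries ℕ ℂ) := by
    intro α
    rw [LinearIsometry.toSpanSingleton_apply, map_smul, map_smul, coeffCLM_apply]
    change (MvPowerSeries.coeff α (G : MvPowerSeries ℕ ℂ) * (Real.sqrt (weight β α) : ℂ)) •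
      (Real.sqrt (weight β α) : ℂ)⁻¹ • _ = _
    rw [smul_eq_mul, smul_eq_mul, mul_assoc, mul_inv_cancel_left₀ (sqrt_weight_ne_zero β α)]
  -- Only the finitely many `α ≤ κ` contribute to the coefficient at `κ`, so the series is the
  -- finite Cauchy product.
  have hz : ∀ α ∉ (Finset.HasAntidiagonal.antidiagonal κ).image Prod.snd,
      MvPowerSeries.coeff α (G : MvPowerSeries ℕ ℂ) *
        MvPowerSeries.coeff κ ((mono α • F : A2 β) : MvPowerSeries ℕ ℂ) = 0 := by
    intro α hα
    by_contra hne
    obtain ⟨τ, rfl, -⟩ := exists_of_coeff_mono_smul_ne_zero β (right_ne_zero_of_mul hne)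
    exact hα (Finset.mem_image.2 ⟨(τ, α), by simp [add_comm], rfl⟩)
  have hs := hasSum_sum_of_ne_finset_zero (L := .unconditional _) hz
  convert hs using 1
  · exact funext e
  · rw [MvPowerSeries.coeff_mul, Finset.sum_image]
    · refine Finset.sum_congr rfl fun x hx => ?_
      rw [← Finset.HasAntidiagonal.mem_antidiagonal.1 hx, add_comm, coeff_add_mono_smul, mul_comm]
    · intro x hx y hy hxy
      refine Prod.ext ?_ hxy
      have hx := Finset.HasAntidiagonal.mem_antidiagonal.1 hx
      have hy := Finset.HasAntidiagonal.mem_antidiagonal.1 hy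
      rw [← hy, hxy] at hx
      exact add_right_cancel hx

/-- Multiplication by an isometric multiplier, as a map of Hilbert modules. -/
theorem IsIsometricMultiplier.exists_moduleMap {β : ℕ → Set.Ici (-1 : ℝ)} {F : A2 β}
    (hF : IsIsometricMultiplier F) :
    ∃ T : A2 β →ₗ[MvPolynomial ℕ ℂ] A2 β, (∀ G, ‖T G‖ = ‖G‖) ∧ ∀ G : A2 β,
      (T G : MvPowerSeries ℕ ℂ) = (F : MvPowerSeries ℕ ℂ) * (G : MvPowerSeries ℕ ℂ) := by
  obtain ⟨T, hT⟩ := hF.exists_linearIsometry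
  refine ⟨{ toFun := T, map_add' := map_add T, map_smul' := fun p G => Subtype.ext ?_ },
    T.norm_map, hT⟩
  rw [RingHom.id_apply, hT, coe_poly_smul, coe_poly_smul, hT]
  ring

/-! ### Isometric module maps and generated submodules -/

theorem mem_generated_iff {β : ℕ → Set.Ici (-1 : ℝ)} {x G : A2 β} :
    G ∈ (generated β {x}).toSubmodule ↔
      ∀ ε > 0, ∃ p : MvPolynomial ℕ ℂ, ‖G - p • x‖ < ε := by
  change G ∈ closure ((Submodule.span (MvPolynomial ℕ ℂ) {x} : Submodule _ (A2 β)) : Set (A2 β)) ↔ _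
  rw [Metric.mem_closure_iff]
  refine forall₂_congr fun ε _ => ?_
  constructor
  · rintro ⟨y, hy, h⟩
    obtain ⟨p, rfl⟩ := Submodule.mem_span_singleton.1 hy
    exact ⟨p, by rwa [← dist_eq_norm]⟩
  · rintro ⟨p, h⟩
    exact ⟨p • x, Submodule.mem_span_singleton.2 ⟨p, rfl⟩, by rwa [dist_eq_norm]⟩

theorem self_mem_generated (β : ℕ → Set.Ici (-1 : ℝ)) (x : A2 β) :
    x ∈ (generated β {x}).toSubmodule :=
  mem_generated_iff.2 fun ε hε => ⟨1, by simpa using hε⟩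

/-- An isometric module map carries `[x]` onto `[T x]`. -/
theorem map_generated_singleton {β : ℕ → Set.Ici (-1 : ℝ)}
    (T : A2 β →ₗ[MvPolynomial ℕ ℂ] A2 β) (hT : ∀ G, ‖T G‖ = ‖G‖) (x : A2 β) :
    (generated β {x}).toSubmodule.map T = (generated β {T x}).toSubmodule := by
  have hiso : Isometry T := AddMonoidHomClass.isometry_of_norm T hT
  -- Completeness of `A²_β` makes the isometry a closed embedding.
  have hcl : IsClosed ((generated β {x}).toSubmodule.map T : Set (A2 β)) := by
    rw [Submodule.map_coe]
    exact hiso.isClosedEmbedding.isClosedMap _ (generated β {x}).isClosed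
  apply le_antisymm
  · rintro _ ⟨G, hG, rfl⟩
    rw [mem_generated_iff]
    intro ε hε
    obtain ⟨p, hp⟩ := mem_generated_iff.1 hG ε hε
    refine ⟨p, ?_⟩
    rwa [← map_smul, ← map_sub, hT]
  · change closure ((Submodule.span (MvPolynomial ℕ ℂ) {T x} : Submodule _ (A2 β)) :
      Set (A2 β)) ⊆ _
    refine closure_minimal ?_ hcl
    exact Submodule.span_le.2 (Set.singleton_subset_iff.2 ⟨x, self_mem_generated β x, rfl⟩)

theorem unitarilyEquivalent_of_map {β : ℕ → Set.Ici (-1 : ℝ)} {M N : HilbertSubmodule β}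
    (T : A2 β →ₗ[MvPolynomial ℕ ℂ] A2 β) (hT : ∀ G, ‖T G‖ = ‖G‖)
    (h : M.toSubmodule.map T = N.toSubmodule) : UnitarilyEquivalent M N := by
  have hinj : Function.Injective T := (AddMonoidHomClass.isometry_of_norm T hT).injective
  exact ⟨(Submodule.equivMapOfInjective T hinj M.toSubmodule).trans (LinearEquiv.ofEq _ _ h),
    fun x => hT x⟩

theorem UnitarilyEquivalent.symm {β : ℕ → Set.Ici (-1 : ℝ)} {M N : HilbertSubmodule β}
    (h : UnitarilyEquivalent M N) : UnitarilyEquivalent N M := by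
  obtain ⟨U, hU⟩ := h
  exact ⟨U.symm, fun x => by rw [← hU, U.apply_symm_apply]⟩

theorem UnitarilyEquivalent.trans {β : ℕ → Set.Ici (-1 : ℝ)} {M N L : HilbertSubmodule β}
    (h : UnitarilyEquivalent M N) (h' : UnitarilyEquivalent N L) : UnitarilyEquivalent M L := by
  obtain ⟨U, hU⟩ := h
  obtain ⟨V, hV⟩ := h'
  exact ⟨U.trans V, fun x => by rw [LinearEquiv.trans_apply, hV, hU]⟩

theorem seriesSet_generated_eq {β : ℕ → Set.Ici (-1 : ℝ)} {F : A2 β}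
    (T : A2 β →ₗ[MvPolynomial ℕ ℂ] A2 β) (hT : ∀ G, ‖T G‖ = ‖G‖)
    (hTF : ∀ G : A2 β,
      (T G : MvPowerSeries ℕ ℂ) = (F : MvPowerSeries ℕ ℂ) * (G : MvPowerSeries ℕ ℂ)) (x : A2 β) :
    seriesSet (generated β {T x}) =
      (fun G : MvPowerSeries ℕ ℂ => (F : MvPowerSeries ℕ ℂ) * G) ''
        seriesSet (generated β {x}) := by
  have h : ((generated β {T x} : HilbertSubmodule β) : Set (A2 β)) =
      T '' ((generated β {x} : HilbertSubmodule β) : Set (A2 β)) :=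
    (congrArg (fun S : Submodule (MvPolynomial ℕ ℂ) (A2 β) => (S : Set (A2 β)))
      (map_generated_singleton T hT x)).symm
  unfold seriesSet
  rw [h, Set.image_image, Set.image_image]
  exact Set.image_congr fun G _ => hTF G

/-- The image of a generator under a unitary equivalence generates. -/
theorem exists_generator_of_unitarilyEquivalent {β : ℕ → Set.Ici (-1 : ℝ)} {x : A2 β}
    {N : HilbertSubmodule β} (h : UnitarilyEquivalent (generated β {x}) N) :
    ∃ K : A2 β, N = generated β {K} ∧ ∀ p : MvPolynomial ℕ ℂ, ‖p • K‖ = ‖p • x‖ := by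
  obtain ⟨U, hU⟩ := h
  set x' : (generated β {x}).toSubmodule := ⟨x, self_mem_generated β x⟩ with hx'
  -- `U` preserves distances to polynomial multiples of the generator, so their density passes from
  -- `x` to `U x`.
  have hn : ∀ (m : (generated β {x}).toSubmodule) (p : MvPolynomial ℕ ℂ),
      ‖((U m : A2 β)) - p • (U x' : A2 β)‖ = ‖(m : A2 β) - p • x‖ := by
    intro m p
    have := hU (m - p • x')
    rw [map_sub, map_smul] at this
    exact this
  refine ⟨U x', ?_, ?_⟩
  · apply SetLike.coe_injective
    apply Set.Subset.antisymm
    · intro G hG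
      have hG' : (U (U.symm ⟨G, hG⟩) : A2 β) = G := by rw [U.apply_symm_apply]
      refine mem_generated_iff.2 fun ε hε => ?_
      obtain ⟨p, hp⟩ := mem_generated_iff.1 (U.symm ⟨G, hG⟩).2 ε hε
      exact ⟨p, by rw [← hG', hn]; exact hp⟩
    · change closure ((Submodule.span (MvPolynomial ℕ ℂ) {(U x' : A2 β)} : Submodule _ (A2 β)) :
        Set (A2 β)) ⊆ _
      refine closure_minimal ?_ N.isClosed
      exact Submodule.span_le.2 (Set.singleton_subset_iff.2 (U x').2)
  · intro p
    have := hU (p • x')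
    rw [map_smul] at this
    exact this

/-- Polarization along the polynomial action. -/
theorem inner_smul_eq_of_norm_eq {β : ℕ → Set.Ici (-1 : ℝ)} {K x : A2 β}
    (h : ∀ p : MvPolynomial ℕ ℂ, ‖p • K‖ = ‖p • x‖) (p q : MvPolynomial ℕ ℂ) :
    inner ℂ (p • K) (q • K) = inner ℂ (p • x) (q • x) := by
  -- Each such sum is again a polynomial multiple; `c = ±1, ±i` are the four terms of the
  -- polarization identity.
  have key : ∀ c : ℂ, ‖p • K + c • q • K‖ = ‖p • x + c • q • x‖ := by
    intro c
    have e : ∀ y : A2 β, p • y + c • q • y = (p + c • q) • y := fun y => by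
      rw [add_smul, smul_assoc]
    rw [e, e, h]
  have h1 := key 1
  have h2 := key (-1)
  have h3 := key Complex.I
  have h4 := key (-Complex.I)
  simp only [one_smul, neg_smul, ← sub_eq_add_neg] at h1 h2 h3 h4
  rw [inner_eq_sum_norm_sq_div_four, inner_eq_sum_norm_sq_div_four]
  simp only [RCLike.I_to_complex, h1, h2, h3, h4]

/-! ### Monomials on the torus -/

theorem torusMonomial_apply (β : ℕ → Set.Ici (-1 : ℝ)) (α : ℕ →₀ ℕ) (t : torus β) :
    torusMonomial β α t = α.prod fun n k => (torusPoint t n : ℂ) ^ k := rfl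

theorem torusMonomial_add (β : ℕ → Set.Ici (-1 : ℝ)) (α δ : ℕ →₀ ℕ) :
    torusMonomial β (α + δ) = torusMonomial β α * torusMonomial β δ := by
  ext t
  simp only [ContinuousMap.mul_apply, torusMonomial_apply]
  exact Finsupp.prod_add_index' (fun _ => pow_zero _) fun _ _ _ => pow_add _ _ _

theorem torusMonomial_zero (β : ℕ → Set.Ici (-1 : ℝ)) : torusMonomial β 0 = 1 := by
  ext t
  simp [torusMonomial_apply]

theorem norm_torusMonomial (β : ℕ → Set.Ici (-1 : ℝ)) (α : ℕ →₀ ℕ) (t : torus β) :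
    ‖torusMonomial β α t‖ = 1 := by
  rw [torusMonomial_apply, Finsupp.prod, norm_prod]
  refine Finset.prod_eq_one fun n _ => ?_
  rw [norm_pow, Circle.norm_coe, one_pow]

theorem conj_mul_torusMonomial (β : ℕ → Set.Ici (-1 : ℝ)) (α : ℕ →₀ ℕ) (t : torus β) :
    conj (torusMonomial β α t) * torusMonomial β α t = 1 := by
  rw [Complex.conj_mul', norm_torusMonomial]
  norm_num

theorem torusPoint_of_notMem {β : ℕ → Set.Ici (-1 : ℝ)} (t : torus β) {n : ℕ}
    (h : n ∉ hardyIndex β) : torusPoint t n = 1 := by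
  unfold torusPoint
  exact dif_neg h

theorem torusPoint_of_mem {β : ℕ → Set.Ici (-1 : ℝ)} (t : torus β) {n : ℕ}
    (h : n ∈ hardyIndex β) : torusPoint t n = t ⟨n, h⟩ := by
  unfold torusPoint
  exact dif_pos h

theorem torusPoint_mul {β : ℕ → Set.Ici (-1 : ℝ)} (s t : torus β) (n : ℕ) :
    torusPoint (s * t) n = torusPoint s n * torusPoint t n := by
  by_cases h : n ∈ hardyIndex β
  · simp only [torusPoint_of_mem _ h, Pi.mul_apply]
  · simp only [torusPoint_of_notMem _ h, mul_one]

theorem torusMonomial_mul_apply (β : ℕ → Set.Ici (-1 : ℝ)) (α : ℕ →₀ ℕ) (s t : torus β) :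
    torusMonomial β α (s * t) = torusMonomial β α s * torusMonomial β α t := by
  simp only [torusMonomial_apply, Finsupp.prod, torusPoint_mul, Circle.coe_mul, mul_pow,
    Finset.prod_mul_distrib]

/-- Points of the torus have entry 1 outside `H`, so the Bergman variables are invisible there. -/
theorem torusMonomial_hardyPart (β : ℕ → Set.Ici (-1 : ℝ)) (α : ℕ →₀ ℕ) :
    torusMonomial β (hardyPart β α) = torusMonomial β α := by
  conv_rhs => rw [← bergmanPart_add_hardyPart β α, torusMonomial_add]
  have : torusMonomial β (bergmanPart β α) = 1 := by
    ext t
    rw [torusMonomial_apply]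
    refine Finset.prod_eq_one fun n _ => ?_
    by_cases h : n ∈ hardyIndex β
    · simp only [bergmanPart_apply_of_mem β α h, pow_zero]
    · simp only [torusPoint_of_notMem t h, Circle.coe_one, one_pow]
  rw [this, one_mul]

instance (β : ℕ → Set.Ici (-1 : ℝ)) : (torusHaar β).IsMulLeftInvariant := by
  unfold torusHaar
  infer_instance

/-- The point `e^i` has infinite order because `π` is irrational. Rotation by it therefore separates
all exponents at once. -/
theorem circle_exp_one_pow_injective : Function.Injective fun k : ℕ => Circle.exp 1 ^ k := by
  intro k l h
  simp only [← Circle.exp_nsmul, nsmul_eq_mul, mul_one] at h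
  obtain ⟨m, hm⟩ := Circle.exp_eq_exp.1 h
  by_contra hne
  have hm0 : (m : ℝ) ≠ 0 := by
    rintro h0
    rw [h0] at hm
    exact hne (by exact_mod_cast (by linarith : (k : ℝ) = l))
  refine irrational_pi ⟨((k : ℚ) - l) / (2 * m), ?_⟩
  push_cast
  rw [div_eq_iff (by positivity)]
  linarith

/-- For `α ≠ α'` the integrand is a nontrivial character: a suitable translation multiplies it by a
constant other than 1, and invariance of Haar measure forces the integral to vanish. -/
theorem integral_conj_mul_torusMonomial (β : ℕ → Set.Ici (-1 : ℝ)) {α α' : ℕ →₀ ℕ}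
    (h : (α.support : Set ℕ) ⊆ hardyIndex β) (h' : (α'.support : Set ℕ) ⊆ hardyIndex β)
    [Decidable (α = α')] :
    ∫ t, conj (torusMonomial β α t) * torusMonomial β α' t ∂(torusHaar β) =
      if α = α' then 1 else 0 := by
  classical
  split_ifs with heq
  · subst heq
    simp [conj_mul_torusMonomial]
  · obtain ⟨n, hn⟩ : ∃ n, α n ≠ α' n := by
      by_contra hcon
      push Not at hcon
      exact heq (Finsupp.ext hcon)
    have hnH : n ∈ hardyIndex β := by
      by_contra hnH
      have e : ∀ δ : ℕ →₀ ℕ, (δ.support : Set ℕ) ⊆ hardyIndex β → δ n = 0 := fun δ hδ => by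
        by_contra h0
        exact hnH (hδ (by simpa using h0))
      exact hn (by rw [e α h, e α' h'])
    -- The translation rotates only a coordinate where the exponents differ.
    set s : torus β := Pi.mulSingle ⟨n, hnH⟩ (Circle.exp 1) with hs
    have hval : ∀ δ : ℕ →₀ ℕ, torusMonomial β δ s = ((Circle.exp 1 ^ δ n : Circle) : ℂ) := by
      intro δ
      have h1 : ∀ m, m ≠ n → torusPoint s m = 1 := by
        intro m hm
        by_cases hmH : m ∈ hardyIndex β
        · rw [torusPoint_of_mem s hmH, hs, Pi.mulSingle_eq_of_ne]
          simpa using hm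
        · exact torusPoint_of_notMem s hmH
      have h2 : torusPoint s n = Circle.exp 1 := by
        rw [torusPoint_of_mem s hnH, hs, Pi.mulSingle_eq_same]
      rw [torusMonomial_apply, Finsupp.prod,
        Finset.prod_eq_single n (fun m _ hm => by rw [h1 m hm]; simp)
          (fun hδ => by rw [Finsupp.notMem_support_iff.1 hδ, pow_zero]), h2, Circle.coe_pow]
    have hne : torusMonomial β α s ≠ torusMonomial β α' s := by
      rw [hval, hval]
      intro hc
      exact hn (circle_exp_one_pow_injective (Circle.coe_injective hc))
    have hinv := integral_mul_left_eq_self (μ := torusHaar β)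
      (fun t => conj (torusMonomial β α t) * torusMonomial β α' t) s
    have e : ∀ t, conj (torusMonomial β α (s * t)) * torusMonomial β α' (s * t) =
        (conj (torusMonomial β α s) * torusMonomial β α' s) *
          (conj (torusMonomial β α t) * torusMonomial β α' t) := by
      intro t
      rw [torusMonomial_mul_apply, torusMonomial_mul_apply, map_mul]
      ring
    simp only [e] at hinv
    rw [integral_const_mul] at hinv
    by_contra hI
    refine hne ?_
    have h1 : conj (torusMonomial β α s) * torusMonomial β α' s = 1 :=
      mul_right_cancel₀ hI (by rw [hinv, one_mul])
    rw [← conj_mul_torusMonomial β α s] at h1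
    exact (mul_left_cancel₀ (left_ne_zero_of_mul_eq_one (conj_mul_torusMonomial β α s)) h1).symm

theorem inner_toLp_torusMonomial (β : ℕ → Set.Ici (-1 : ℝ)) {α α' : ℕ →₀ ℕ}
    (h : (α.support : Set ℕ) ⊆ hardyIndex β) (h' : (α'.support : Set ℕ) ⊆ hardyIndex β)
    [Decidable (α = α')] :
    inner ℂ (ContinuousMap.toLp (E := ℂ) 2 (torusHaar β) ℂ (torusMonomial β α))
      (ContinuousMap.toLp (E := ℂ) 2 (torusHaar β) ℂ (torusMonomial β α')) =
        if α = α' then (1 : ℂ) else 0 := by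
  rw [← integral_conj_mul_torusMonomial β h h', L2.inner_def]
  refine integral_congr_ae ?_
  filter_upwards [ContinuousMap.coeFn_toLp (p := 2) (𝕜 := ℂ) (torusHaar β) (torusMonomial β α),
    ContinuousMap.coeFn_toLp (p := 2) (𝕜 := ℂ) (torusHaar β) (torusMonomial β α')] with t h1 h2
  rw [h1, h2, RCLike.inner_apply, mul_comm]

/-! ### Boundary functions -/

theorem exists_isBoundaryFunction {β : ℕ → Set.Ici (-1 : ℝ)} {F : A2 β} (hF : F ∈ hardySpace β) :
    ∃ g : Lp ℂ 2 (torusHaar β), IsBoundaryFunction F g := by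
  classical
  -- Orthonormality needs this restriction: exponents with the same Hardy part give the same
  -- function on the torus.
  set S : Set (ℕ →₀ ℕ) := {α | (α.support : Set ℕ) ⊆ hardyIndex β} with hS
  have hon : Orthonormal ℂ fun α : S =>
      ContinuousMap.toLp (E := ℂ) 2 (torusHaar β) ℂ (torusMonomial β α) := by
    rw [orthonormal_iff_ite]
    intro α α'
    rw [inner_toLp_torusMonomial β α.2 α'.2]
    simp only [Subtype.ext_iff]
  have h1 : Summable fun α : S => ‖MvPowerSeries.coeff (α : ℕ →₀ ℕ) (F : MvPowerSeries ℕ ℂ)‖ ^ 2 := by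
    refine ((norm_sq_eq β F).summable.comp_injective Subtype.val_injective).congr fun α => ?_
    simp only [Function.comp_apply, weight_of_support_subset_hardyIndex β α.2, mul_one]
  have h2 := (hon.orthogonalFamily.summable_iff_norm_sq_summable
    (fun α : S => MvPowerSeries.coeff (α : ℕ →₀ ℕ) (F : MvPowerSeries ℕ ℂ))).2 h1
  refine ⟨_, (Subtype.val_injective.hasSum_iff ?_).1 h2.hasSum⟩
  intro α hα
  have : MvPowerSeries.coeff α (F : MvPowerSeries ℕ ℂ) = 0 := by
    by_contra hne
    exact hα ⟨⟨α, hF α hne⟩, rfl⟩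
  rw [this, zero_smul]

theorem IsBoundaryFunction.inner_eq {β : ℕ → Set.Ici (-1 : ℝ)} {F G : A2 β}
    (hF : F ∈ hardySpace β) (hG : G ∈ hardySpace β) {f g : Lp ℂ 2 (torusHaar β)}
    (hf : IsBoundaryFunction F f) (hg : IsBoundaryFunction G g) :
    inner ℂ f g = inner ℂ F G := by
  classical
  have h1 : ∀ α' : ℕ →₀ ℕ, (α'.support : Set ℕ) ⊆ hardyIndex β →
      inner ℂ (ContinuousMap.toLp (E := ℂ) 2 (torusHaar β) ℂ (torusMonomial β α')) f =
        MvPowerSeries.coeff α' (F : MvPowerSeries ℕ ℂ) := by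
    intro α' hα'
    have h := (innerSL ℂ
      (ContinuousMap.toLp (E := ℂ) 2 (torusHaar β) ℂ (torusMonomial β α'))).hasSum hf
    refine h.unique ?_
    refine (hasSum_ite_eq α' (MvPowerSeries.coeff α' (F : MvPowerSeries ℕ ℂ))).congr_fun ?_
    intro α
    rw [innerSL_apply_apply, inner_smul_right]
    by_cases h0 : MvPowerSeries.coeff α (F : MvPowerSeries ℕ ℂ) = 0
    · rw [h0, zero_mul]
      split_ifs with h
      · rw [← h, h0]
      · rfl
    · rw [inner_toLp_torusMonomial β hα' (hF α h0)]
      by_cases h : α = α'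
      · simp [h]
      · simp [h, Ne.symm h]
  have h := (innerSL ℂ f).hasSum hg
  refine h.unique ?_
  refine (hasSum_inner β F G).congr_fun ?_
  intro α
  rw [innerSL_apply_apply, inner_smul_right]
  by_cases h0 : MvPowerSeries.coeff α (G : MvPowerSeries ℕ ℂ) = 0
  · simp [h0]
  · rw [← inner_conj_symm, h1 α (hG α h0), weight_of_support_subset_hardyIndex β (hG α h0)]
    push_cast
    ring

/-- Multiplication by `ζ^α` on `L²(𝕋^H)`. -/
def torusMul (β : ℕ → Set.Ici (-1 : ℝ)) (α : ℕ →₀ ℕ) :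
    Lp ℂ 2 (torusHaar β) →L[ℂ] Lp ℂ 2 (torusHaar β) :=
  (ContinuousLinearMap.mul ℂ ℂ).holderL (torusHaar β) ⊤ 2 2
    (ContinuousMap.toLp (E := ℂ) ⊤ (torusHaar β) ℂ (torusMonomial β α))

theorem coeFn_torusMul (β : ℕ → Set.Ici (-1 : ℝ)) (α : ℕ →₀ ℕ) (g : Lp ℂ 2 (torusHaar β)) :
    torusMul β α g =ᵐ[torusHaar β] fun t => torusMonomial β α t * g t := by
  have h := (ContinuousLinearMap.mul ℂ ℂ).coeFn_holder (r := 2)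
    (ContinuousMap.toLp (E := ℂ) ⊤ (torusHaar β) ℂ (torusMonomial β α)) g
  filter_upwards [h, ContinuousMap.coeFn_toLp (p := ⊤) (𝕜 := ℂ) (torusHaar β)
    (torusMonomial β α)] with t h1 h2
  rw [h2] at h1
  exact h1

theorem IsBoundaryFunction.mono_smul {β : ℕ → Set.Ici (-1 : ℝ)} {F : A2 β}
    {f : Lp ℂ 2 (torusHaar β)} (hf : IsBoundaryFunction F f) (α : ℕ →₀ ℕ) :
    IsBoundaryFunction (mono α • F) (torusMul β α f) := by
  have h := (torusMul β α).hasSum hf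
  unfold IsBoundaryFunction
  rw [← (add_right_injective α).hasSum_iff]
  · convert h using 2 with κ
    simp only [Function.comp_apply]
    rw [coeff_add_mono_smul, map_smul]
    congr 1
    refine Lp.ext ?_
    filter_upwards [coeFn_torusMul β α
        (ContinuousMap.toLp (E := ℂ) 2 (torusHaar β) ℂ (torusMonomial β κ)),
      ContinuousMap.coeFn_toLp (p := 2) (𝕜 := ℂ) (torusHaar β) (torusMonomial β κ),
      ContinuousMap.coeFn_toLp (p := 2) (𝕜 := ℂ) (torusHaar β) (torusMonomial β (α + κ))]
      with t h1 h2 h3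
    rw [h1, h2, h3, torusMonomial_add, ContinuousMap.mul_apply]
  · intro x hx
    have : MvPowerSeries.coeff x ((mono α • F : A2 β) : MvPowerSeries ℕ ℂ) = 0 := by
      by_contra hne
      obtain ⟨τ, rfl, -⟩ := exists_of_coeff_mono_smul_ne_zero β hne
      exact hx ⟨τ, rfl⟩
    rw [this, zero_smul]

/-- This bridges the two descriptions of inner functions: Gram entries of the multiples of `F` are
Fourier coefficients of `|F*|² dσ_H`. The density is kept in `NNReal` to match integrals against
`withDensity`. -/
theorem IsBoundaryFunction.inner_mono_smul {β : ℕ → Set.Ici (-1 : ℝ)} {F : A2 β}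
    (hF : F ∈ hardySpace β) {f : Lp ℂ 2 (torusHaar β)} (hf : IsBoundaryFunction F f)
    {α α' : ℕ →₀ ℕ} (h : (α.support : Set ℕ) ⊆ hardyIndex β)
    (h' : (α'.support : Set ℕ) ⊆ hardyIndex β) :
    inner ℂ (mono α • F) (mono α' • F) =
      ∫ t, (‖f t‖₊ ^ 2) • (conj (torusMonomial β α t) * torusMonomial β α' t) ∂(torusHaar β) := by
  rw [← IsBoundaryFunction.inner_eq (mono_smul_mem_hardySpace β h hF)
    (mono_smul_mem_hardySpace β h' hF) (hf.mono_smul α) (hf.mono_smul α'), L2.inner_def]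
  refine integral_congr_ae ?_
  filter_upwards [coeFn_torusMul β α f, coeFn_torusMul β α' f] with t h1 h2
  rw [h1, h2, RCLike.inner_apply, map_mul, NNReal.smul_def]
  have e : conj (f t) * f t = ((‖f t‖ : ℂ)) ^ 2 := Complex.conj_mul' _
  rw [NNReal.coe_pow, coe_nnnorm, Complex.real_smul, Complex.ofReal_pow, ← e]
  ring

theorem IsInner.isIsometricMultiplier {β : ℕ → Set.Ici (-1 : ℝ)} {F : A2 β} (hF : IsInner F) :
    IsIsometricMultiplier F := by
  classical
  refine ⟨hF.mem_hardySpace, fun α α' h h' => ?_⟩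
  obtain ⟨g, hg, hg1⟩ := hF.boundary
  rw [hg.inner_mono_smul hF.mem_hardySpace h h', inner_zetaPow,
    weight_of_support_subset_hardyIndex β h, Complex.ofReal_one,
    ← integral_conj_mul_torusMonomial β h h']
  refine integral_congr_ae ?_
  filter_upwards [hg1] with t ht
  have : ‖g t‖₊ = 1 := NNReal.eq ht
  simp [this]

/-! ### Uniqueness of Fourier coefficients on the torus -/

instance (β : ℕ → Set.Ici (-1 : ℝ)) : PolishSpace (torus β) := by
  let := TopologicalSpace.metrizableSpaceMetric (torus β)
  infer_instance

/-- The monomials as bounded continuous functions. -/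
def boundedMonomial (β : ℕ → Set.Ici (-1 : ℝ)) (α : ℕ →₀ ℕ) :
    BoundedContinuousFunction (torus β) ℂ :=
  BoundedContinuousFunction.mkOfCompact (torusMonomial β α)

theorem boundedMonomial_apply (β : ℕ → Set.Ici (-1 : ℝ)) (α : ℕ →₀ ℕ) (t : torus β) :
    boundedMonomial β α t = torusMonomial β α t := rfl

/-- Functions of this form are closed under products, so the star algebra generated by the monomials
is spanned by them. -/
theorem exists_eq_of_mem_closure_boundedMonomial (β : ℕ → Set.Ici (-1 : ℝ))
    {f : BoundedContinuousFunction (torus β) ℂ}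
    (hf : f ∈ Submonoid.closure
      (Set.range (boundedMonomial β) ∪ star (Set.range (boundedMonomial β)))) :
    ∃ α α', ∀ t, f t = conj (torusMonomial β α t) * torusMonomial β α' t := by
  induction hf using Submonoid.closure_induction with
  | mem f hf =>
    rcases hf with ⟨α, rfl⟩ | ⟨α, hα⟩
    · exact ⟨0, α, fun t => by simp [torusMonomial_zero, boundedMonomial_apply]⟩
    · refine ⟨α, 0, fun t => ?_⟩
      have : f = star (boundedMonomial β α) := by rw [hα, star_star]
      rw [this, torusMonomial_zero]
      simp [boundedMonomial_apply]
  | one => exact ⟨0, 0, fun t => by simp [torusMonomial_zero]⟩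
  | mul f g _ _ hf hg =>
    obtain ⟨α, α', h⟩ := hf
    obtain ⟨δ, δ', h'⟩ := hg
    refine ⟨α + δ, α' + δ', fun t => ?_⟩
    rw [BoundedContinuousFunction.mul_apply, h, h', torusMonomial_add, torusMonomial_add,
      ContinuousMap.mul_apply, ContinuousMap.mul_apply, map_mul]
    ring

/-- The monomials generate a star algebra that separates points, since it contains the coordinates;
integrals over such an algebra determine a finite measure on a Polish space. -/
theorem measure_ext_of_fourier (β : ℕ → Set.Ici (-1 : ℝ)) {μ ν : Measure (torus β)}
    [IsFiniteMeasure μ] [IsFiniteMeasure ν]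
    (h : ∀ α α' : ℕ →₀ ℕ, (α.support : Set ℕ) ⊆ hardyIndex β →
      (α'.support : Set ℕ) ⊆ hardyIndex β →
      ∫ t, conj (torusMonomial β α t) * torusMonomial β α' t ∂μ =
        ∫ t, conj (torusMonomial β α t) * torusMonomial β α' t ∂ν) : μ = ν := by
  refine ext_of_forall_mem_subalgebra_integral_eq_of_polish (𝕜 := ℂ)
    (A := StarAlgebra.adjoin ℂ (Set.range (boundedMonomial β))) ?_ ?_
  · intro s t hst
    obtain ⟨⟨n, hn⟩, hne⟩ := Function.ne_iff.1 hst
    refine ⟨torusMonomial β (Finsupp.single n 1), ⟨torusMonomial β (Finsupp.single n 1),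
      ⟨boundedMonomial β (Finsupp.single n 1), StarAlgebra.subset_adjoin ℂ _ ⟨_, rfl⟩, rfl⟩, rfl⟩, ?_⟩
    have e : ∀ r : torus β, torusMonomial β (Finsupp.single n 1) r = (r ⟨n, hn⟩ : ℂ) := by
      intro r
      rw [← torusPoint_of_mem r hn]
      exact (Finsupp.prod_single_index (h := fun m k => (torusPoint r m : ℂ) ^ k)
        (pow_zero _)).trans (pow_one _)
    rw [e, e]
    exact fun hc => hne (Circle.coe_injective hc)
  · intro g hg
    replace hg : g ∈ Submodule.span ℂ (Submonoid.closure (Set.range (boundedMonomial β) ∪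
        star (Set.range (boundedMonomial β))) : Set (BoundedContinuousFunction (torus β) ℂ)) := by
      rw [← Algebra.adjoin_eq_span, ← StarAlgebra.adjoin_toSubalgebra]
      exact hg
    induction hg using Submodule.span_induction with
    | mem f hf =>
      obtain ⟨α, α', e⟩ := exists_eq_of_mem_closure_boundedMonomial β hf
      simp only [e]
      -- The exponents found may involve Bergman variables; passing to Hardy parts does not change
      -- the functions.
      rw [← torusMonomial_hardyPart β α, ← torusMonomial_hardyPart β α']
      exact h _ _ (support_hardyPart β α) (support_hardyPart β α')
    | zero => simp
    | add f g _ _ hf hg =>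
      simp only [BoundedContinuousFunction.add_apply]
      rw [integral_add (f.integrable μ) (g.integrable μ),
        integral_add (f.integrable ν) (g.integrable ν), hf, hg]
    | smul c f _ hf =>
      simp only [BoundedContinuousFunction.smul_apply]
      rw [integral_smul, integral_smul, hf]

/-- The measures `|g|² dσ_H` and `σ_H` have the same Fourier coefficients, hence coincide, and
densities are unique almost everywhere. -/
theorem IsIsometricMultiplier.norm_boundary_eq_one {β : ℕ → Set.Ici (-1 : ℝ)} {F : A2 β}
    (hF : IsIsometricMultiplier F) {g : Lp ℂ 2 (torusHaar β)} (hg : IsBoundaryFunction F g) :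
    ∀ᵐ t ∂(torusHaar β), ‖g t‖ = 1 := by
  classical
  have hmeas : Measurable fun t => ‖g t‖₊ ^ 2 :=
    ((Lp.stronglyMeasurable g).measurable.nnnorm).pow_const 2
  have hfin : ∫⁻ t, ((‖g t‖₊ ^ 2 : NNReal) : ENNReal) ∂(torusHaar β) ≠ ⊤ := by
    have h1 : Integrable (fun t => ‖g t‖ ^ 2) (torusHaar β) :=
      (Lp.memLp g).integrable_norm_pow (p := 2) two_ne_zero
    have h2 := h1.2.ne
    convert h2 using 3 with t
    rw [ENNReal.coe_pow, enorm_pow, enorm_norm]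
    rfl
  set ν := (torusHaar β).withDensity fun t => ((‖g t‖₊ ^ 2 : NNReal) : ENNReal) with hν
  have : IsFiniteMeasure ν := isFiniteMeasure_withDensity hfin
  have hνσ : ν = torusHaar β := by
    refine measure_ext_of_fourier β fun α α' h h' => ?_
    rw [hν, integral_withDensity_eq_integral_smul hmeas,
      ← hg.inner_mono_smul hF.mem_hardySpace h h', hF.inner_eq α α' h h', inner_zetaPow,
      weight_of_support_subset_hardyIndex β h, Complex.ofReal_one,
      integral_conj_mul_torusMonomial β h h']
  have h1 : (torusHaar β).withDensity (fun t => ((‖g t‖₊ ^ 2 : NNReal) : ENNReal)) =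
      (torusHaar β).withDensity (fun _ => 1) := by
    rw [withDensity_const, one_smul]
    exact hνσ
  rw [withDensity_eq_iff hmeas.coe_nnreal_ennreal.aemeasurable aemeasurable_const hfin] at h1
  filter_upwards [h1] with t ht
  have ht : ‖g t‖₊ ^ 2 = 1 := by exact_mod_cast ht
  have ht : ‖g t‖ ^ 2 = 1 := by
    rw [← coe_nnnorm, ← NNReal.coe_pow, ht, NNReal.coe_one]
  exact (pow_eq_one_iff_of_nonneg (norm_nonneg _) two_ne_zero).1 ht

/-! ### Boundedness of isometric multipliers -/

/-- `∑_α x^α = ∏ₙ (1 - xₙ)⁻¹` converges. -/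
theorem summable_finsupp_prod_pow {x : ℕ → ℝ} (h0 : ∀ n, 0 ≤ x n) (h1 : ∀ n, x n < 1)
    (hx : Summable x) : Summable fun α : ℕ →₀ ℕ => α.prod fun n k => x n ^ k := by
  classical
  have hy : Summable fun n => x n * (1 - x n)⁻¹ := by
    refine Summable.mul_tendsto_const (c := (1 : ℝ)) (by simpa using hx.abs) ?_
    have : Filter.Tendsto (fun n => (1 - x n)⁻¹) Filter.cofinite (nhds (1 - 0)⁻¹) :=
      (tendsto_const_nhds.sub hx.tendsto_cofinite_zero).inv₀ (by norm_num)
    simpa using this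
  have hy0 : ∀ n, 0 ≤ x n * (1 - x n)⁻¹ := fun n =>
    mul_nonneg (h0 n) (inv_nonneg.2 (by linarith [h1 n]))
  -- Here `1/(1 - x) = 1 + x/(1 - x) ≤ exp(x/(1 - x))`, which turns the product over `n` into the
  -- exponential of a convergent sum.
  have hgeom : ∀ n M, ∑ k ∈ Finset.range M, x n ^ k ≤ Real.exp (x n * (1 - x n)⁻¹) := by
    intro n M
    have hpos : 0 < 1 - x n := by linarith [h1 n]
    refine (sum_le_hasSum _ (fun k _ => pow_nonneg (h0 n) k)
      (hasSum_geometric_of_lt_one (h0 n) (h1 n))).trans ?_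
    refine le_trans (le_of_eq ?_) (Real.add_one_le_exp _)
    field_simp
    ring
  refine summable_of_sum_le (c := Real.exp (∑' n, x n * (1 - x n)⁻¹))
    (fun α => Finset.prod_nonneg fun n _ => pow_nonneg (h0 n) _) fun s => ?_
  -- A finite set of exponents lies in a box with `N` variables and degrees below `M`, over which
  -- the sum factors.
  obtain ⟨N, hN⟩ : ∃ N : ℕ, ∀ α ∈ s, α.support ⊆ Finset.range N := by
    obtain ⟨N, hN⟩ := (s.biUnion Finsupp.support).exists_nat_subset_range
    exact ⟨N, fun α hα => (Finset.subset_biUnion_of_mem Finsupp.support hα).trans hN⟩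
  obtain ⟨M, hM⟩ : ∃ M : ℕ, ∀ α ∈ s, ∀ n, α n < M := by
    refine ⟨s.sup (fun α => α.degree) + 1, fun α hα n => Nat.lt_succ_of_le ?_⟩
    exact (Finsupp.le_degree n α).trans (Finset.le_sup (f := fun α : ℕ →₀ ℕ => α.degree) hα)
  have hprod : ∀ α ∈ s, (α.prod fun n k => x n ^ k) = ∏ i : Fin N, x i ^ α i := by
    intro α hα
    rw [Finset.prod_fin_eq_prod_range]
    rw [Finsupp.prod_of_support_subset α (hN α hα) _ (fun n _ => pow_zero _)]
    refine Finset.prod_congr rfl fun n hn => ?_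
    rw [dif_pos (Finset.mem_range.1 hn)]
  calc ∑ α ∈ s, (α.prod fun n k => x n ^ k)
      = ∑ α ∈ s, ∏ i : Fin N, x i ^ α i := Finset.sum_congr rfl hprod
    _ = ∑ f ∈ s.image (fun α (i : Fin N) => α i), ∏ i : Fin N, x i ^ f i := by
      rw [Finset.sum_image]
      intro α hα α' hα' h
      ext n
      by_cases hn : n < N
      · exact congrFun h ⟨n, hn⟩
      · have e : ∀ δ ∈ s, δ n = 0 := fun δ hδ => by
          by_contra hne
          exact hn (Finset.mem_range.1 (hN δ hδ (Finsupp.mem_support_iff.2 hne)))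
        rw [e α hα, e α' hα']
    _ ≤ ∑ f ∈ Fintype.piFinset fun _ : Fin N => Finset.range M, ∏ i : Fin N, x i ^ f i := by
      refine Finset.sum_le_sum_of_subset_of_nonneg ?_ fun f _ _ =>
        Finset.prod_nonneg fun i _ => pow_nonneg (h0 _) _
      intro f hf
      obtain ⟨α, hα, rfl⟩ := Finset.mem_image.1 hf
      exact Fintype.mem_piFinset.2 fun i => Finset.mem_range.2 (hM α hα i)
    _ = ∏ i : Fin N, ∑ k ∈ Finset.range M, x i ^ k :=
      (Finset.prod_univ_sum (fun _ : Fin N => Finset.range M) fun i k => x i ^ k).symm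
    _ ≤ ∏ i : Fin N, Real.exp (x i * (1 - x i)⁻¹) :=
      Finset.prod_le_prod (fun i _ => Finset.sum_nonneg fun k _ => pow_nonneg (h0 _) k)
        fun i _ => hgeom i M
    _ = Real.exp (∑ n ∈ Finset.range N, x n * (1 - x n)⁻¹) := by
      rw [← Real.exp_sum, Finset.sum_range fun n => x n * (1 - x n)⁻¹]
    _ ≤ Real.exp (∑' n, x n * (1 - x n)⁻¹) :=
      Real.exp_le_exp.2 (hy.sum_le_tsum _ fun n _ => hy0 n)

theorem summable_norm_prod_sq {β : ℕ → Set.Ici (-1 : ℝ)} {z : ℕ → ℂ} (hz : z ∈ hardyDisk β) :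
    Summable fun α : ℕ →₀ ℕ => ‖α.prod fun n k => z n ^ k‖ ^ 2 := by
  have h := summable_finsupp_prod_pow (x := fun n => ‖z n‖ ^ 2) (fun n => sq_nonneg _)
    (fun n => pow_lt_one₀ (norm_nonneg _) (hz.2.1 n) two_ne_zero) hz.1
  refine h.congr fun α => ?_
  rw [Finsupp.prod, Finsupp.prod, norm_prod, ← Finset.prod_pow]
  refine Finset.prod_congr rfl fun n _ => ?_
  rw [norm_pow, ← pow_mul, ← pow_mul, mul_comm]

/-- For `α` supported in `H` the weight is 1 and this is `2ab ≤ a² + b²`; otherwise `z^α = 0`. -/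
theorem norm_coeff_mul_prod_le {β : ℕ → Set.Ici (-1 : ℝ)} {z : ℕ → ℂ} (hz : z ∈ hardyDisk β)
    (F : A2 β) (α : ℕ →₀ ℕ) :
    ‖MvPowerSeries.coeff α (F : MvPowerSeries ℕ ℂ) * α.prod fun n k => z n ^ k‖ ≤
      (‖MvPowerSeries.coeff α (F : MvPowerSeries ℕ ℂ)‖ ^ 2 * weight β α +
        ‖α.prod fun n k => z n ^ k‖ ^ 2) / 2 := by
  by_cases h : (α.support : Set ℕ) ⊆ hardyIndex β
  · rw [weight_of_support_subset_hardyIndex β h, mul_one, norm_mul]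
    linarith [two_mul_le_add_sq ‖MvPowerSeries.coeff α (F : MvPowerSeries ℕ ℂ)‖
      ‖α.prod fun n k => z n ^ k‖]
  · obtain ⟨n, hn, hnH⟩ := Set.not_subset.1 h
    have h0 : (α.prod fun n k => z n ^ k) = 0 := by
      refine Finset.prod_eq_zero (i := n) hn ?_
      change z n ^ α n = 0
      rw [hz.2.2 n hnH, zero_pow (Finsupp.mem_support_iff.1 hn)]
    rw [h0, mul_zero, norm_zero]
    have := (weight_pos β α).le
    positivity

theorem summable_norm_coeff_mul_prod {β : ℕ → Set.Ici (-1 : ℝ)} {z : ℕ → ℂ}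
    (hz : z ∈ hardyDisk β) (F : A2 β) :
    Summable fun α : ℕ →₀ ℕ =>
      ‖MvPowerSeries.coeff α (F : MvPowerSeries ℕ ℂ) * α.prod fun n k => z n ^ k‖ :=
  Summable.of_nonneg_of_le (fun _ => norm_nonneg _) (norm_coeff_mul_prod_le hz F)
    (((norm_sq_eq β F).summable.add (summable_norm_prod_sq hz)).div_const 2)

/-- The bound is not sharp, but for fixed `z` it depends on `F` only through `‖F‖`, which suffices
for the power argument. -/
theorem norm_evalAt_le {β : ℕ → Set.Ici (-1 : ℝ)} {z : ℕ → ℂ} (hz : z ∈ hardyDisk β) (F : A2 β) :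
    ‖evalAt (F : MvPowerSeries ℕ ℂ) z‖ ≤
      (‖F‖ ^ 2 + ∑' α : ℕ →₀ ℕ, ‖α.prod fun n k => z n ^ k‖ ^ 2) / 2 :=
  tsum_of_norm_bounded
    (((norm_sq_eq β F).add (summable_norm_prod_sq hz).hasSum).div_const 2)
    (norm_coeff_mul_prod_le hz F)

theorem evalAt_mul {β : ℕ → Set.Ici (-1 : ℝ)} {z : ℕ → ℂ} (hz : z ∈ hardyDisk β) (F G : A2 β) :
    evalAt ((F : MvPowerSeries ℕ ℂ) * (G : MvPowerSeries ℕ ℂ)) z =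
      evalAt (F : MvPowerSeries ℕ ℂ) z * evalAt (G : MvPowerSeries ℕ ℂ) z := by
  have key : ∀ f g : (ℕ →₀ ℕ) → ℂ, Summable (fun α => ‖f α‖) → Summable (fun α => ‖g α‖) →
      (∑' α, f α) * ∑' α, g α =
        ∑' κ, ∑ x ∈ Finset.HasAntidiagonal.antidiagonal κ, f x.1 * g x.2 := fun f g hf hg =>
    hf.of_norm.tsum_mul_tsum_eq_tsum_sum_antidiagonal hg.of_norm
      (summable_mul_of_summable_norm hf hg)
  unfold evalAt
  rw [key _ _ (summable_norm_coeff_mul_prod hz F) (summable_norm_coeff_mul_prod hz G)]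
  refine tsum_congr fun κ => ?_
  rw [MvPowerSeries.coeff_mul, Finset.sum_mul]
  refine Finset.sum_congr rfl fun x hx => ?_
  rw [← Finset.HasAntidiagonal.mem_antidiagonal.1 hx,
    Finsupp.prod_add_index' (fun _ => pow_zero _) fun _ _ _ => pow_add _ _ _]
  ring

/-- All powers `F^k` have the norm of 1, so the numbers `|F(z)|^k` are bounded in `k`, which
excludes `|F(z)| > 1`. -/
theorem IsIsometricMultiplier.norm_evalAt_le_one {β : ℕ → Set.Ici (-1 : ℝ)} {F : A2 β}
    (hF : IsIsometricMultiplier F) {z : ℕ → ℂ} (hz : z ∈ hardyDisk β) :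
    ‖evalAt (F : MvPowerSeries ℕ ℂ) z‖ ≤ 1 := by
  obtain ⟨T, hT⟩ := hF.exists_linearIsometry
  have hpow : ∀ k : ℕ, ∃ G : A2 β, ‖G‖ = ‖one β‖ ∧
      evalAt (G : MvPowerSeries ℕ ℂ) z =
        evalAt (F : MvPowerSeries ℕ ℂ) z ^ k * evalAt (one β : MvPowerSeries ℕ ℂ) z := by
    intro k
    induction k with
    | zero => exact ⟨one β, rfl, by rw [pow_zero, one_mul]⟩
    | succ k ih =>
      obtain ⟨G, hG, hGe⟩ := ih
      refine ⟨T G, by rw [T.norm_map, hG], ?_⟩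
      rw [hT, evalAt_mul hz, hGe]
      ring
  have hone : evalAt (one β : MvPowerSeries ℕ ℂ) z = 1 := by
    classical
    unfold evalAt
    rw [tsum_eq_single 0 fun α hα => by rw [coeff_one_eq, if_neg hα, zero_mul]]
    rw [coeff_one_eq, if_pos rfl, Finsupp.prod_zero_index, mul_one]
  by_contra hlt
  obtain ⟨k, hk⟩ := pow_unbounded_of_one_lt
    ((‖one β‖ ^ 2 + ∑' α : ℕ →₀ ℕ, ‖α.prod fun n k => z n ^ k‖ ^ 2) / 2) (not_le.1 hlt)
  obtain ⟨G, hG, hGe⟩ := hpow k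
  have h := norm_evalAt_le hz G
  rw [hG, hGe, hone, mul_one, norm_pow] at h
  exact absurd hk (not_lt.2 h)

theorem IsIsometricMultiplier.isInner {β : ℕ → Set.Ici (-1 : ℝ)} {F : A2 β}
    (hF : IsIsometricMultiplier F) : IsInner F := by
  obtain ⟨g, hg⟩ := exists_isBoundaryFunction hF.mem_hardySpace
  exact ⟨hF.mem_hardySpace, ⟨1, fun z hz => hF.norm_evalAt_le_one hz⟩,
    ⟨g, hg, hF.norm_boundary_eq_one hg⟩⟩

/-! ### Generators of submodules in the orbit -/

theorem hasSum_norm_sq_mono_smul (β : ℕ → Set.Ici (-1 : ℝ)) (α : ℕ →₀ ℕ) (F : A2 β) :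
    HasSum (fun κ : ℕ →₀ ℕ => ‖MvPowerSeries.coeff κ (F : MvPowerSeries ℕ ℂ)‖ ^ 2 *
      weight β (α + κ)) (‖mono α • F‖ ^ 2) := by
  have h := hasSum_inner_mono_smul β α F F
  have e : inner ℂ (mono α • F) (mono α • F) = ((‖mono α • F‖ : ℝ) : ℂ) ^ 2 :=
    inner_self_eq_norm_sq_to_K _
  simp only [e, Complex.conj_mul'] at h
  exact_mod_cast h

/-- A shift in the Hardy variables leaves the Bergman part of every exponent, and hence its weight,
unchanged. -/
theorem norm_mono_smul_of_support_subset (β : ℕ → Set.Ici (-1 : ℝ)) {α : ℕ →₀ ℕ}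
    (h : (α.support : Set ℕ) ⊆ hardyIndex β) (G : A2 β) : ‖mono α • G‖ = ‖G‖ := by
  have h1 := hasSum_norm_sq_mono_smul β α G
  have e : ∀ κ, weight β (α + κ) = weight β κ := fun κ => by
    rw [weight_eq_weight_bergmanPart, bergmanPart_add, (bergmanPart_eq_zero_iff β α).2 h, zero_add,
      ← weight_eq_weight_bergmanPart]
  simp only [e] at h1
  exact (sq_eq_sq₀ (norm_nonneg _) (norm_nonneg _)).1 (h1.unique (norm_sq_eq β G))

theorem norm_zetaPow_sq (β : ℕ → Set.Ici (-1 : ℝ)) (α : ℕ →₀ ℕ) :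
    ‖zetaPow β α‖ ^ 2 = weight β α := by
  classical
  have h := inner_zetaPow β α α
  have e : inner ℂ (zetaPow β α) (zetaPow β α) = ((‖zetaPow β α‖ : ℝ) : ℂ) ^ 2 :=
    inner_self_eq_norm_sq_to_K _
  rw [if_pos rfl, e] at h
  exact_mod_cast h

theorem weight_single_add (β : ℕ → Set.Ici (-1 : ℝ)) (α : ℕ →₀ ℕ) (n : ℕ) :
    weight β (Finsupp.single n 1 + α) * (α n + β n + 2) = weight β α * (α n + 1) := by
  have hb : (-1 : ℝ) ≤ β n := (β n).2
  have h1 : 0 < Real.Gamma ((β n : ℝ) + 2) := Real.Gamma_pos_of_pos (by linarith)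
  have hj : (0 : ℝ) ≤ α n := Nat.cast_nonneg _
  have h2 : 0 < Real.Gamma ((α n : ℝ) + (β n : ℝ) + 2) := Real.Gamma_pos_of_pos (by linarith)
  have h3 : Real.Gamma (((1 + α n : ℕ) : ℝ) + β n + 2) =
      ((α n : ℝ) + β n + 2) * Real.Gamma ((α n : ℝ) + β n + 2) := by
    rw [← Real.Gamma_add_one (by linarith)]
    congr 1
    push_cast
    ring
  have hz : ∀ m, (Nat.factorial 0 : ℝ) * Real.Gamma ((β m : ℝ) + 2) /
      Real.Gamma (((0 : ℕ) : ℝ) + (β m : ℝ) + 2) = 1 := fun m => by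
    have hm : (-1 : ℝ) ≤ β m := (β m).2
    have : 0 < Real.Gamma ((β m : ℝ) + 2) := Real.Gamma_pos_of_pos (by linarith)
    simp [this.ne']
  have herase : (Finsupp.single n 1 + α).erase n = α.erase n := by
    rw [Finsupp.erase_add, Finsupp.erase_single, zero_add]
  have hval : (Finsupp.single n 1 + α : ℕ →₀ ℕ) n = 1 + α n := by simp
  unfold weight
  rw [← Finsupp.mul_prod_erase' _ n _ (fun m => hz m), ← Finsupp.mul_prod_erase' α n _ (fun m => hz m),
    herase, hval, h3, add_comm 1 (α n), Nat.factorial_succ]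
  push_cast
  have : (α n : ℝ) + β n + 2 ≠ 0 := by linarith
  field_simp

/-- A combination of the squared norms of `ζ^κ`, `ζₙ ζ^κ` and `ζₙ² ζ^κ` which vanishes exactly
when `κₙ = g`. -/
theorem weight_combination (β : ℕ → Set.Ici (-1 : ℝ)) {n : ℕ} (hn : n ∉ hardyIndex β) (g : ℝ) :
    ∃ x y z : ℝ, ∀ κ : ℕ →₀ ℕ,
      x * weight β κ + y * weight β (Finsupp.single n 1 + κ) +
        z * weight β (Finsupp.single n 1 + (Finsupp.single n 1 + κ)) =
      weight β κ * (κ n - g) ^ 2 / ((κ n + β n + 2) * (κ n + β n + 3)) := by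
  have hb : (-1 : ℝ) < β n := lt_of_le_of_ne (β n).2 (Ne.symm hn)
  set b : ℝ := (β n : ℝ) with hbdef
  have hb1 : b + 1 ≠ 0 := by linarith
  have hb2 : b + 2 ≠ 0 := by linarith
  -- With `j = κₙ`, the requirement is `x(j+b+2)(j+b+3) + y(j+1)(j+b+3) + z(j+1)(j+2) = (j-g)²`.
  -- Setting `j = -1` gives `x`, setting `j = -b-3` gives `z`, and the leading coefficient gives `x
  -- + y + z = 1`. Division by `b + 1` is where `n ∉ H` enters.
  refine ⟨(1 + g) ^ 2 / ((b + 1) * (b + 2)),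
    1 - (1 + g) ^ 2 / ((b + 1) * (b + 2)) - (g + b + 3) ^ 2 / ((b + 1) * (b + 2)),
    (g + b + 3) ^ 2 / ((b + 1) * (b + 2)), fun κ => ?_⟩
  have e1 := weight_single_add β κ n
  have e2 := weight_single_add β (Finsupp.single n 1 + κ) n
  have hval : (((Finsupp.single n 1 + κ : ℕ →₀ ℕ) n : ℕ) : ℝ) = 1 + κ n := by simp
  rw [hval] at e2
  rw [← hbdef] at e1 e2
  have hj : (0 : ℝ) ≤ κ n := Nat.cast_nonneg _
  generalize (κ n : ℝ) = j at *
  have hj2 : j + b + 2 ≠ 0 := by linarith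
  have hj3 : j + b + 3 ≠ 0 := by linarith
  have hj3' : 1 + j + b + 2 ≠ 0 := by linarith
  rw [← eq_div_iff hj3'] at e2
  rw [← eq_div_iff hj2] at e1
  rw [e2, e1, show 1 + j + b + 2 = j + b + 3 by ring]
  field_simp
  ring

/-- The combination of `‖K‖²`, `‖ζₙK‖²`, `‖ζₙ²K‖²` given by `weight_combination` takes the value it
has on `ζ^γ`, which is zero. As a sum of nonnegative terms over the coefficients of `K`, it vanishes
term by term. -/
theorem apply_eq_of_coeff_ne_zero {β : ℕ → Set.Ici (-1 : ℝ)} {γ : ℕ →₀ ℕ} {K : A2 β}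
    (hK : ∀ p : MvPolynomial ℕ ℂ, ‖p • K‖ = ‖p • zetaPow β γ‖) {n : ℕ} (hn : n ∉ hardyIndex β)
    {κ : ℕ →₀ ℕ} (hκ : MvPowerSeries.coeff κ (K : MvPowerSeries ℕ ℂ) ≠ 0) : κ n = γ n := by
  obtain ⟨x, y, z, h⟩ := weight_combination β hn (γ n)
  have hs : ∀ α : ℕ →₀ ℕ, HasSum (fun κ : ℕ →₀ ℕ =>
      ‖MvPowerSeries.coeff κ (K : MvPowerSeries ℕ ℂ)‖ ^ 2 * weight β (α + κ))
        (weight β (α + γ)) := by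
    intro α
    have h := hasSum_norm_sq_mono_smul β α K
    rwa [hK, mono_smul_zetaPow, norm_zetaPow_sq] at h
  have hsum := (((hs 0).mul_left x).add ((hs (Finsupp.single n 1)).mul_left y)).add
    ((hs (Finsupp.single n 1 + Finsupp.single n 1)).mul_left z)
  rw [zero_add, add_assoc (Finsupp.single n 1), h γ, sub_self, zero_pow two_ne_zero, mul_zero,
    zero_div] at hsum
  have hsum : HasSum (fun κ : ℕ →₀ ℕ => ‖MvPowerSeries.coeff κ (K : MvPowerSeries ℕ ℂ)‖ ^ 2 *
      (weight β κ * (κ n - γ n) ^ 2 / ((κ n + β n + 2) * (κ n + β n + 3)))) 0 := by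
    refine hsum.congr_fun fun κ => ?_
    rw [← h κ, zero_add, add_assoc (Finsupp.single n 1)]
    ring
  have hb : (-1 : ℝ) ≤ β n := (β n).2
  have hpos : ∀ κ : ℕ →₀ ℕ, 0 < ((κ n : ℝ) + β n + 2) * (κ n + β n + 3) := fun κ => by
    have hj : (0 : ℝ) ≤ κ n := Nat.cast_nonneg _
    exact mul_pos (by linarith) (by linarith)
  have hzero := (hasSum_zero_iff_of_nonneg fun κ => by
    have := weight_pos β κ
    have := hpos κ
    positivity).1 hsum
  have hz := congrFun hzero κ
  simp only [Pi.zero_apply] at hz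
  rw [mul_eq_zero, or_iff_right (pow_ne_zero 2 (norm_ne_zero_iff.2 hκ)), div_eq_zero_iff,
    or_iff_left (hpos κ).ne', mul_eq_zero, or_iff_right (weight_pos β κ).ne',
    pow_eq_zero_iff two_ne_zero, sub_eq_zero] at hz
  exact_mod_cast hz

/-- All exponents of `K` have Bergman part `γ̃`, so `K` can be divided by `ζ^γ̃` with quotient in
the Hardy space. Polarizing the norm identity and cancelling the common factor `ω_γ̃` gives the
orthonormality relations. -/
theorem exists_isIsometricMultiplier {β : ℕ → Set.Ici (-1 : ℝ)} {γ : ℕ →₀ ℕ} {K : A2 β}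
    (hK : ∀ p : MvPolynomial ℕ ℂ, ‖p • K‖ = ‖p • zetaPow β γ‖) :
    ∃ F : A2 β, IsIsometricMultiplier F ∧ K = mono (bergmanPart β γ) • F := by
  classical
  have hbp : ∀ κ, MvPowerSeries.coeff κ (K : MvPowerSeries ℕ ℂ) ≠ 0 →
      bergmanPart β κ = bergmanPart β γ := by
    intro κ hκ
    ext n
    by_cases hn : n ∈ hardyIndex β
    · rw [bergmanPart_apply_of_mem β _ hn, bergmanPart_apply_of_mem β _ hn]
    · rw [bergmanPart_apply_of_notMem β _ hn, bergmanPart_apply_of_notMem β _ hn,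
        apply_eq_of_coeff_ne_zero hK hn hκ]
  have hsupp : ∀ τ, MvPowerSeries.coeff (bergmanPart β γ + τ) (K : MvPowerSeries ℕ ℂ) ≠ 0 →
      (τ.support : Set ℕ) ⊆ hardyIndex β := by
    intro τ hτ
    have := hbp _ hτ
    rw [bergmanPart_add, bergmanPart_bergmanPart] at this
    exact (bergmanPart_eq_zero_iff β τ).1 (add_eq_left.1 this)
  let f : MvPowerSeries ℕ ℂ := fun τ =>
    MvPowerSeries.coeff (bergmanPart β γ + τ) (K : MvPowerSeries ℕ ℂ)
  have hf : ∀ τ, MvPowerSeries.coeff τ f =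
    MvPowerSeries.coeff (bergmanPart β γ + τ) (K : MvPowerSeries ℕ ℂ) := fun τ => rfl
  -- On the support of `f` the weight of `γ̃ + τ` is the constant `ω_γ̃`, so summability for `K`
  -- divided by it is summability for `f`.
  have hfmem : f ∈ A2 β := by
    have h := ((norm_sq_eq β K).summable.comp_injective
      (add_right_injective (bergmanPart β γ))).div_const (weight β (bergmanPart β γ))
    refine h.congr fun τ => ?_
    simp only [Function.comp_apply]
    rw [hf]
    by_cases h0 : MvPowerSeries.coeff (bergmanPart β γ + τ) (K : MvPowerSeries ℕ ℂ) = 0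
    · simp [h0]
    · rw [weight_bergmanPart_add β γ (hsupp τ h0),
        weight_of_support_subset_hardyIndex β (hsupp τ h0), mul_one,
        mul_div_cancel_right₀ _ (weight_pos β _).ne']
  set F : A2 β := ⟨f, hfmem⟩
  have hF : F ∈ hardySpace β := fun τ hτ => hsupp τ hτ
  have hKF : K = mono (bergmanPart β γ) • F := by
    refine Subtype.ext (MvPowerSeries.ext fun κ => ?_)
    by_cases hle : bergmanPart β γ ≤ κ
    · obtain ⟨τ, rfl⟩ := exists_add_of_le hle
      rw [coeff_add_mono_smul]
      rfl
    · rw [coe_mono_smul, MvPowerSeries.coeff_monomial_mul, if_neg hle]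
      by_contra h0
      refine hle ?_
      rw [← hbp κ h0]
      conv_rhs => rw [← bergmanPart_add_hardyPart β κ]
      exact le_self_add
  refine ⟨F, ⟨hF, fun α α' h h' => ?_⟩, hKF⟩
  have h1 := inner_smul_eq_of_norm_eq hK (mono α) (mono α')
  have e : ∀ δ : ℕ →₀ ℕ, mono δ • K = mono (bergmanPart β γ) • (mono δ • F) := fun δ => by
    rw [hKF, smul_comm]
  have hw : weight β (α + γ) = weight β (bergmanPart β γ) := by
    rw [weight_eq_weight_bergmanPart, bergmanPart_add, (bergmanPart_eq_zero_iff β α).2 h, zero_add]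
  rw [e, e, inner_mono_bergmanPart_smul β γ γ (mono_smul_mem_hardySpace β h hF)
    (mono_smul_mem_hardySpace β h' hF), if_pos rfl, mono_smul_zetaPow, mono_smul_zetaPow,
    inner_zetaPow, hw] at h1
  have hw0 : (weight β (bergmanPart β γ) : ℂ) ≠ 0 := by
    exact_mod_cast (weight_pos β _).ne'
  refine mul_left_cancel₀ hw0 ?_
  rw [h1, inner_zetaPow, weight_of_support_subset_hardyIndex β h]
  simp

theorem unitarilyEquivalent_bergmanPart (β : ℕ → Set.Ici (-1 : ℝ)) (γ : ℕ →₀ ℕ) :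
    UnitarilyEquivalent (generated β {zetaPow β γ})
      (generated β {zetaPow β (bergmanPart β γ)}) := by
  have hT : ∀ G : A2 β,
      ‖LinearMap.lsmul (MvPolynomial ℕ ℂ) (A2 β) (mono (hardyPart β γ)) G‖ = ‖G‖ :=
    norm_mono_smul_of_support_subset β (support_hardyPart β γ)
  -- Multiplication by the Hardy part goes from `[ζ^γ̃]` to `[ζ^γ]`, hence the reversal.
  refine (unitarilyEquivalent_of_map _ hT ?_).symm
  rw [map_generated_singleton _ hT, LinearMap.lsmul_apply, mono_smul_zetaPow, add_comm,
    bergmanPart_add_hardyPart]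

end WeightedBergman

end

theorem theorem4p3 (β : ℕ → Set.Ici (-1 : ℝ)) (γ : ℕ →₀ ℕ) :
    WeightedBergman.seriesSet ''
        WeightedBergman.unitaryOrbit
          (WeightedBergman.generated β {WeightedBergman.zetaPow β γ}) =
      {S : Set (MvPowerSeries ℕ ℂ) | ∃ F : WeightedBergman.A2 β, WeightedBergman.IsInner F ∧
        S = (fun G : MvPowerSeries ℕ ℂ => (F : MvPowerSeries ℕ ℂ) * G) ''
          WeightedBergman.seriesSet (WeightedBergman.generated β
            {WeightedBergman.zetaPow β (WeightedBergman.bergmanPart β γ)})} := by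
  ext S
  constructor
  · rintro ⟨N, hN, rfl⟩
    obtain ⟨K, rfl, hK⟩ := WeightedBergman.exists_generator_of_unitarilyEquivalent hN
    obtain ⟨F, hF, rfl⟩ := WeightedBergman.exists_isIsometricMultiplier hK
    obtain ⟨T, hT, hTF⟩ := hF.exists_moduleMap
    refine ⟨F, hF.isInner, ?_⟩
    -- It remains to compare generators: `ζ^γ̃ F` and `T ζ^γ̃` are the same series.
    rw [← WeightedBergman.seriesSet_generated_eq T hT hTF]
    congr 3
    refine Subtype.ext ?_
    rw [hTF, WeightedBergman.zetaPow_eq, WeightedBergman.coe_mono_smul,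
      WeightedBergman.coe_mono_smul, mul_comm]
    change _ = _ * (_ * 1)
    rw [mul_one]
  · rintro ⟨F, hF, rfl⟩
    obtain ⟨T, hT, hTF⟩ := hF.isIsometricMultiplier.exists_moduleMap
    refine ⟨WeightedBergman.generated β
      {T (WeightedBergman.zetaPow β (WeightedBergman.bergmanPart β γ))}, ?_,
      WeightedBergman.seriesSet_generated_eq T hT hTF _⟩
    exact (WeightedBergman.unitarilyEquivalent_bergmanPart β γ).trans
      (WeightedBergman.unitarilyEquivalent_of_map T hT
        (WeightedBergman.map_generated_singleton T hT _))
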